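/- A \emph{Halin graph} is a graph $H=T\cup C$ obtained as follows: take a finite tree $T$ in which every non-leaf has degree at least $3$, embed it in the plane, and add new edges forming a cycle $C$ whose vertices are exactly the leaves of $T$, in such a way that the resulting graph $H$ is planar. Let $\mathrm{ex}_{\mathcal H}(n,C_4)$ be the maximum number of edges in an $n$-vertex Halin graph that contains no cycle of length $4$ as a (not necessarily induced) subgraph. Then, for every integer $n\ge 16$, this maximum exists (i.e. there is at least one such graph) and $$\mathrm{ex}_{\mathcal H}(n,C_4)=\begin{cases}\frac53(n-1), & 3\mid n-1,\\[2pt] \frac53(n-2)+1, & 3\mid n-2,\\[2pt] \frac53(n-3)+3, & 3\mid n-3.\end{cases}$$ -/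

import Mathlib

/-- A rotation system on a graph: a permutation of the darts (oriented edges) that keeps the
initial vertex of a dart and whose restriction to the darts leaving any fixed vertex is one single
cycle. It is the cyclic order in which the edges leave each vertex in a drawing of the graph on an
oriented surface. -/
def IsRotationSystem {V : Type*} {G : SimpleGraph V} (σ : Equiv.Perm G.Dart) : Prop :=
  (∀ d, (σ d).fst = d.fst) ∧ ∀ d d' : G.Dart, d.fst = d'.fst → σ.SameCycle d d'

/-- The face permutation of a rotation system: walk along a dart, then leave its end vertex through
the dart that follows the reversed dart in the rotation. Its cycles are the face boundaries. -/
def facePerm {V : Type*} {G : SimpleGraph V} (σ : Equiv.Perm G.Dart) : Equiv.Perm G.Dart :=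
  (SimpleGraph.Dart.symm_involutive (G := G)).toPerm.trans σ

/-- The number of faces of a rotation system, summed over the connected components of the graph
(each component is drawn on a surface of its own): the number of cycles of the face permutation,
fixed points included, plus one face for each isolated vertex, which has no darts. -/
noncomputable def numFaces {V : Type*} {G : SimpleGraph V} (σ : Equiv.Perm G.Dart) : ℕ :=
  Nat.card (Quotient (Equiv.Perm.SameCycle.setoid (facePerm σ))) +
    {v : V | ∀ w, ¬ G.Adj v w}.ncard

/-- A finite graph is planar if it has a combinatorial plane embedding: a rotation system of genus
zero, i.e. one for which Euler's formula `v - e + f = 2` holds on every component. (For every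
rotation system each component satisfies `v - e + f ≤ 2`, so it suffices to require the sum of
these equations.) -/
def IsPlanarGraph {V : Type*} [Finite V] (G : SimpleGraph V) : Prop :=
  ∃ σ : Equiv.Perm G.Dart, IsRotationSystem σ ∧
    Nat.card V + numFaces σ = G.edgeSet.ncard + 2 * Nat.card G.ConnectedComponent

/-- The set of leaves (vertices of degree one) of a graph. -/
def leafSet {V : Type*} (T : SimpleGraph V) : Set V :=
  {v | (T.neighborSet v).ncard = 1}

/-- `C`, regarded as a set of edges, is a cycle (of length `k ≥ 3`) whose vertices are exactly the
elements of `S`. -/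
def IsCycleOn {V : Type*} (C : SimpleGraph V) (S : Set V) : Prop :=
  ∃ k : ℕ, 3 ≤ k ∧ ∃ f : Fin k ↪ V, Set.range f = S ∧ C = (SimpleGraph.cycleGraph k).map f

/-- A finite graph `H` is a Halin graph if `H = T ∪ C`, where `T` is a tree in which each non-leaf
has degree at least three, `C` is a cycle through exactly the leaves of `T` all of whose edges are
new, and the resulting graph is planar. -/
def IsHalinGraph {V : Type*} [Finite V] (H : SimpleGraph V) : Prop :=
  ∃ T C : SimpleGraph V,
    T.IsTree ∧ (∀ v, v ∉ leafSet T → 3 ≤ (T.neighborSet v).ncard) ∧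
    IsCycleOn C (leafSet T) ∧ Disjoint T C ∧ H = T ⊔ C ∧ IsPlanarGraph H

/-- `m` is the Halin Turán number of `F` for `n` vertices: the maximum of the numbers of edges of
the `n`-vertex Halin graphs that contain no copy of `F` as a (not necessarily induced) subgraph. -/
def IsHalinTuranNumber {W : Type*} (n : ℕ) (F : SimpleGraph W) (m : ℕ) : Prop :=
  IsGreatest {e : ℕ | ∃ H : SimpleGraph (Fin n),
    IsHalinGraph H ∧ F.Free H ∧ H.edgeSet.ncard = e} m

/-! Let `H = T ∪ C` have `n` vertices and `k` leaves. Then `H` has `n - 1 + k` edges, so the task is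
to maximise `k`; the answer is the largest `k` with `3k + 2 ≤ 2n`.

Upper bound. A plane embedding has one outer face, bounded by `C`, and `k` inner faces. Of the `2(n
- 1 + k)` darts, `k` lie on the outer face, so the inner faces have total length `2n + k - 2`.
Without 4-cycles an inner face is a triangle or has length at least 5. A triangle must use an edge
of `C` whose ends have a common parent, and two consecutive edges of `C` cannot both be of this
kind, so there are at most `k/2` triangles. Hence `5k ≤ (2n + k - 2) + 2(k/2)`, which is the bound
(`three_mul_le`).

The outer face is not part of the combinatorial definition of planarity and is recovered by linear
algebra over `ZMod 2`. The jumps of a function on faces across the edges form an even subgraph. An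
even subgraph of a tree is empty, so a function without jumps on `C` is constant, and every rotation
system has at most `k + 1` faces (`card_face_le`). In genus zero equality holds, so some function
jumps across every edge of `C` and across no edge of `T` (`exists_coloring`). One of its two colours
is exactly the outer face (`sameCycle_of_eq_one`).

Lower bound. In a plane rooted tree every vertex owns an interval of leaves, and each dart can be
labelled by the face on its left: a gap between consecutive leaves, or the outer face. The labels
determine the rotation and give at least `k + 1` faces, so `card_face_le` yields planarity
(`isPlanarGraph_halin`). Explicit trees attain the bound: a root with two-leaf hubs for `n ≡ 1` mod
3, and the same tree with one deeper branch for the other residues. 4-cycles are excluded by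
conditions on the parents of nearby leaves (`cycleGraph_four_free`). -/

open Finset in
open Classical in
/-- An even subgraph of an acyclic graph is empty, in terms of its indicator function. -/
theorem SimpleGraph.IsAcyclic.eq_zero_of_even {V : Type*} [Fintype V] {T : SimpleGraph V}
    (hT : T.IsAcyclic) (g : V → V → ZMod 2) (hsymm : ∀ u v, g u v = g v u)
    (hsupp : ∀ u v, ¬ T.Adj u v → g u v = 0) (heven : ∀ v, ∑ w, g v w = 0) (u v : V) :
    g u v = 0 := by
  by_contra hne
  have huv : T.Adj u v := by
    by_contra h
    exact hne (hsupp u v h)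
  have hb : T.IsBridge s(u, v) := SimpleGraph.isAcyclic_iff_forall_adj_isBridge.1 hT huv
  rw [SimpleGraph.isBridge_iff] at hb
  set T' := T.deleteEdges {s(u, v)} with hT'
  -- `A` is the side of `u` after removal of the bridge `uv`. Summing the parity conditions over `A`
  -- counts inner edges twice, so only the bridge survives.
  set A : Finset V := univ.filter (fun x => T'.Reachable u x) with hA
  have h0 : ∑ x ∈ A, ∑ w, g x w = 0 := sum_eq_zero fun x _ => heven x
  have hsplit : ∀ x, ∑ w, g x w = ∑ w ∈ A, g x w + ∑ w ∈ Aᶜ, g x w := fun x =>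
    (sum_add_sum_compl A _).symm
  simp_rw [hsplit, sum_add_distrib] at h0
  have h1 : ∑ x ∈ A, ∑ w ∈ A, g x w = 0 := by
    rw [← sum_product']
    refine sum_involution (fun p _ => p.swap) ?_ ?_ ?_ ?_
    · rintro ⟨a, b⟩ _
      simp only [Prod.swap]
      rw [hsymm b a]
      exact CharTwo.add_self_eq_zero _
    · rintro ⟨a, b⟩ _ hab heq
      simp only [Prod.swap, Prod.mk.injEq] at heq
      rw [heq.1] at hab
      exact hab (hsupp _ _ (T.irrefl))
    · rintro ⟨a, b⟩ h
      simp only [mem_product, Prod.swap] at h ⊢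
      exact ⟨h.2, h.1⟩
    · rintro ⟨a, b⟩ _
      rfl
  have hcross : ∀ x ∈ A, ∀ w ∈ Aᶜ, T.Adj x w → x = u ∧ w = v := by
    intro x hx w hw hxw
    simp only [hA, mem_compl, mem_filter, mem_univ, true_and] at hx hw
    have hn : ¬ T'.Adj x w := fun h => hw (hx.trans h.reachable)
    simp only [hT', SimpleGraph.deleteEdges_adj, Set.mem_singleton_iff, not_and, not_not] at hn
    have := hn hxw
    rw [Sym2.eq_iff] at this
    rcases this with h | ⟨rfl, rfl⟩
    · exact h
    · exact absurd hx hb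
  have h2 : ∑ x ∈ A, ∑ w ∈ Aᶜ, g x w = g u v := by
    rw [sum_eq_single_of_mem u (by simp [hA])]
    · rw [sum_eq_single_of_mem v (by simpa [hA] using hb)]
      intro w hw hwv
      refine hsupp _ _ fun h => hwv (hcross u (by simp [hA]) w hw h).2
    · intro x hx hxu
      refine sum_eq_zero fun w hw => hsupp _ _ fun h => hxu (hcross x hx w hw h).1
  rw [h1, h2, zero_add] at h0
  exact hne h0

/-! ### Functions on the faces modulo 2 and their jumps across edges -/

section FaceFunctions

variable {V : Type*} {G : SimpleGraph V}

open Classical in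
/-- The jump of a function on darts across an edge. -/
noncomputable def dartJump (s : G.Dart → ZMod 2) (u v : V) : ZMod 2 :=
  if h : G.Adj u v then s ⟨(u, v), h⟩ + s ⟨(v, u), h.symm⟩ else 0

theorem dartJump_eq (s : G.Dart → ZMod 2) (d : G.Dart) :
    dartJump s d.fst d.snd = s d + s d.symm := by
  rw [dartJump, dif_pos d.adj]
  rfl

theorem dartJump_comm (s : G.Dart → ZMod 2) (u v : V) : dartJump s u v = dartJump s v u := by
  by_cases h : G.Adj u v
  · rw [dartJump, dartJump, dif_pos h, dif_pos h.symm, add_comm]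
  · rw [dartJump, dartJump, dif_neg h, dif_neg fun h' => h h'.symm]

/-- Since `facePerm σ d.symm = σ d`, a function that is constant on faces cannot tell rotation from
reversal. -/
theorem rotation_apply_eq {σ : Equiv.Perm G.Dart} {α : Type*} {s : G.Dart → α}
    (hs : ∀ d, s (facePerm σ d) = s d) (d : G.Dart) : s (σ d) = s d.symm := by
  rw [← hs d.symm]
  simp [facePerm]

-- The rotation permutes the darts leaving `v`, and `s d.symm = s (σ d)`; so both halves of the
-- jumps at `v` have the same sum and cancel modulo 2.
open Finset in
open Classical in
theorem sum_dartJump_eq_zero [Fintype V] {σ : Equiv.Perm G.Dart} (hσ : ∀ d, (σ d).fst = d.fst)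
    {s : G.Dart → ZMod 2} (hs : ∀ d, s (facePerm σ d) = s d) (v : V) :
    ∑ w, dartJump s v w = 0 := by
  have h1 : ∑ d : G.Dart with d.fst = v, (s d + s d.symm) = ∑ w, dartJump s v w := by
    refine sum_of_injOn (fun d => d.snd) ?_ (fun _ _ => mem_coe.2 (mem_univ _)) ?_ ?_
    · intro d hd d' hd' h
      simp only [coe_filter, mem_univ, true_and, Set.mem_ofPred_eq] at hd hd'
      exact SimpleGraph.Dart.ext _ _ (Prod.ext (hd.trans hd'.symm) h)
    · intro w _ hw
      rw [dartJump, dif_neg]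
      intro h
      exact hw ⟨⟨(v, w), h⟩, by simp, rfl⟩
    · intro d hd
      simp only [mem_filter, mem_univ, true_and] at hd
      rw [← dartJump_eq, hd]
  have h2 : ∑ d : G.Dart with d.fst = v, s d.symm = ∑ d : G.Dart with d.fst = v, s d := by
    refine sum_bij (fun d _ => σ d) ?_ (fun _ _ _ _ h => σ.injective h) ?_ ?_
    · intro d hd
      simpa [hσ d] using hd
    · intro d hd
      refine ⟨σ.symm d, ?_, by simp⟩
      have := hσ (σ.symm d)
      rw [Equiv.apply_symm_apply] at this
      simpa [← this] using hd
    · intro d _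
      exact (rotation_apply_eq hs d).symm
  rw [← h1, sum_add_distrib, h2]
  exact CharTwo.add_self_eq_zero _

/-- If nothing jumps, rotation preserves the value, which makes it constant around each vertex;
reversal then carries it along walks. -/
theorem eq_of_forall_eq_symm {σ : Equiv.Perm G.Dart} (hσ : IsRotationSystem σ)
    (hG : G.Preconnected) {α : Type*} {s : G.Dart → α} (hs : ∀ d, s (facePerm σ d) = s d)
    (hsymm : ∀ d, s d = s d.symm) (d d' : G.Dart) : s d = s d' := by
  have hrot : ∀ d d' : G.Dart, d.fst = d'.fst → s d = s d' := by
    intro d d' h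
    obtain ⟨i, rfl⟩ := hσ.2 d d' h
    clear h
    have hstep : ∀ d, s (σ d) = s d := fun d => (rotation_apply_eq hs d).trans (hsymm d).symm
    induction i with
    | zero => rfl
    | succ i ih => rw [ih, add_comm, zpow_add, zpow_one, Equiv.Perm.mul_apply, hstep]
    | pred i ih =>
      rw [ih, ← hstep ((σ ^ (-(i : ℤ) - 1)) d), ← Equiv.Perm.mul_apply, ← zpow_one_add]
      congr 3
      ring
  obtain ⟨p⟩ := hG d.fst d'.fst
  suffices ∀ u v (p : G.Walk u v) (d d' : G.Dart), d.fst = u → d'.fst = v → s d = s d' from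
    this _ _ p d d' rfl rfl
  clear p
  intro u v p
  induction p with
  | nil => exact fun d d' h h' => hrot d d' (h.trans h'.symm)
  | cons h p ih =>
    intro d d' hd hd'
    rw [hrot d ⟨(_, _), h⟩ hd, hsymm]
    exact ih _ _ rfl hd'

end FaceFunctions

/-! ### Union of a tree and a cycle through its leaves: counting and colouring faces -/

section TreeCycleUnion

variable {V : Type*} {m : ℕ}

theorem Fin.add_one_add_one_ne (i : Fin (m + 3)) : i + 1 + 1 ≠ i := by
  intro h
  have h2 : (1 + 1 : Fin (m + 3)) = 0 := by
    rw [add_assoc] at h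
    simpa using h
  have := congrArg Fin.val h2
  simp [Fin.val_add, Nat.mod_eq_of_lt] at this

theorem Fin.add_one_ne (i : Fin (m + 3)) : i + 1 ≠ i := by
  simp

/-- Adjacency in the closed walk through the vertices `f 0, f 1, …`. -/
def CycAdj (f : Fin (m + 3) → V) (u v : V) : Prop :=
  ∃ i, (u = f i ∧ v = f (i + 1)) ∨ (u = f (i + 1) ∧ v = f i)

theorem map_cycleGraph_adj (f : Fin (m + 3) ↪ V) (u v : V) :
    ((SimpleGraph.cycleGraph (m + 3)).map f).Adj u v ↔ CycAdj f u v := by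
  simp only [SimpleGraph.map_adj, CycAdj, SimpleGraph.cycleGraph_adj]
  constructor
  · rintro ⟨i, j, h | h, rfl, rfl⟩
    · exact ⟨j, Or.inr ⟨by rw [← h]; simp, rfl⟩⟩
    · exact ⟨i, Or.inl ⟨rfl, by rw [← h]; simp⟩⟩
  · rintro ⟨i, ⟨rfl, rfl⟩ | ⟨rfl, rfl⟩⟩
    · exact ⟨i, i + 1, by simp, rfl, rfl⟩
    · exact ⟨i + 1, i, by simp, rfl, rfl⟩

open Finset in
open Classical in
theorem sum_cycAdj_eq_zero [Fintype V] {f : Fin (m + 3) → V} (hf : Function.Injective f) (v : V) :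
    ∑ w, (if CycAdj f v w then (1 : ZMod 2) else 0) = 0 := by
  by_cases hv : ∃ i, v = f i
  · obtain ⟨i, rfl⟩ := hv
    have hset : univ.filter (CycAdj f (f i)) = {f (i + 1), f (i - 1)} := by
      ext w
      simp only [CycAdj, mem_filter, mem_univ, true_and, mem_insert, mem_singleton]
      constructor
      · rintro ⟨j, ⟨h, rfl⟩ | ⟨h, rfl⟩⟩
        · exact Or.inl (by rw [hf h])
        · exact Or.inr (by rw [hf h]; simp)
      · rintro (rfl | rfl)
        · exact ⟨i, Or.inl ⟨rfl, rfl⟩⟩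
        · exact ⟨i - 1, Or.inr ⟨by simp, rfl⟩⟩
    have hne : f (i + 1) ≠ f (i - 1) := by
      intro h
      have h' := hf h
      apply Fin.add_one_add_one_ne i
      rw [h']
      simp
    rw [← sum_filter, hset, sum_pair hne]
    exact CharTwo.add_self_eq_zero _
  · refine sum_eq_zero fun w _ => if_neg ?_
    rintro ⟨i, ⟨h, -⟩ | ⟨h, -⟩⟩ <;> exact hv ⟨_, h⟩

/-- `H` is the union of a tree `T` and a cycle `f 0, f 1, …` through leaves of `T`, no two of which
are adjacent in `T`. -/
structure IsTreeCycleUnion (H T : SimpleGraph V) (f : Fin (m + 3) → V) : Prop where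
  isTree : T.IsTree
  injective : Function.Injective f
  adj_iff : ∀ u v, H.Adj u v ↔ T.Adj u v ∨ CycAdj f u v
  leaf_unique : ∀ i v w, T.Adj (f i) v → T.Adj (f i) w → v = w
  leaf_not_adj : ∀ i j, ¬ T.Adj (f i) (f j)

namespace IsTreeCycleUnion

variable {H T : SimpleGraph V} {f : Fin (m + 3) → V}

theorem disjoint (h : IsTreeCycleUnion H T f) (u v : V) (huv : T.Adj u v) : ¬ CycAdj f u v := by
  rintro ⟨i, ⟨rfl, rfl⟩ | ⟨rfl, rfl⟩⟩ <;> exact h.leaf_not_adj _ _ huv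

theorem le (h : IsTreeCycleUnion H T f) : T ≤ H := fun u v huv => (h.adj_iff u v).2 (Or.inl huv)

theorem preconnected (h : IsTreeCycleUnion H T f) : H.Preconnected :=
  h.isTree.connected.preconnected.mono h.le

/-- The dart of the cycle from `f i` to `f (i + 1)`. -/
def cycDart (h : IsTreeCycleUnion H T f) (i : Fin (m + 3)) : H.Dart :=
  ⟨(f i, f (i + 1)), (h.adj_iff _ _).2 (Or.inr ⟨i, Or.inl ⟨rfl, rfl⟩⟩)⟩

theorem adj_or_eq_cycDart (h : IsTreeCycleUnion H T f) (d : H.Dart) :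
    T.Adj d.fst d.snd ∨ ∃ i, d = h.cycDart i ∨ d = (h.cycDart i).symm := by
  refine ((h.adj_iff _ _).1 d.adj).imp_right ?_
  rintro ⟨i, ⟨h1, h2⟩ | ⟨h1, h2⟩⟩
  · exact ⟨i, Or.inl (SimpleGraph.Dart.ext _ _ (Prod.ext h1 h2))⟩
  · exact ⟨i, Or.inr (SimpleGraph.Dart.ext _ _ (Prod.ext h1 h2))⟩

theorem not_adj_cycDart (h : IsTreeCycleUnion H T f) (i : Fin (m + 3)) :
    ¬ T.Adj (f i) (f (i + 1)) := fun h' => h.disjoint _ _ h' ⟨i, Or.inl ⟨rfl, rfl⟩⟩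

variable {σ : Equiv.Perm H.Dart}

-- A constant jump `c` on the cycle contributes `2c = 0` at every vertex, so the jumps on tree edges
-- alone are even and vanish by acyclicity. It is used with `c = 0` for the kernel and `c = 1` for
-- the colouring.
open Finset in
open Classical in
theorem eq_symm_of_tree_adj [Fintype V] (h : IsTreeCycleUnion H T f)
    (hσ : ∀ d, (σ d).fst = d.fst) {s : H.Dart → ZMod 2} (hs : ∀ d, s (facePerm σ d) = s d)
    {c : ZMod 2} (hc : ∀ i, s (h.cycDart i) + s (h.cycDart i).symm = c) (d : H.Dart)
    (hd : T.Adj d.fst d.snd) : s d = s d.symm := by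
  have hcyc : ∀ u v, CycAdj f u v → dartJump s u v = c := by
    rintro u v ⟨i, ⟨rfl, rfl⟩ | ⟨rfl, rfl⟩⟩
    · exact (dartJump_eq s (h.cycDart i)).trans (hc i)
    · rw [dartJump_comm]
      exact (dartJump_eq s (h.cycDart i)).trans (hc i)
  have key := h.isTree.isAcyclic.eq_zero_of_even
    (fun u v => if T.Adj u v then dartJump s u v else 0)
    (fun u v => by simp only [dartJump_comm s u v, T.adj_comm u v])
    (fun u v huv => if_neg huv) (fun v => ?_) d.fst d.snd
  · simp only [if_pos hd, dartJump_eq] at key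
    exact CharTwo.add_eq_zero.1 key
  · have h1 := sum_dartJump_eq_zero hσ hs v
    have h2 : ∀ w, dartJump s v w = (if T.Adj v w then dartJump s v w else 0) +
        c * (if CycAdj f v w then (1 : ZMod 2) else 0) := by
      intro w
      by_cases ht : T.Adj v w
      · simp [ht, h.disjoint _ _ ht]
      · by_cases hcw : CycAdj f v w
        · simp [ht, hcw, hcyc _ _ hcw]
        · rw [dartJump, dif_neg]
          · simp [ht, hcw]
          · rw [h.adj_iff]
            tauto
    rw [sum_congr rfl fun w _ => h2 w, sum_add_distrib, ← mul_sum,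
      sum_cycAdj_eq_zero h.injective, mul_zero, add_zero] at h1
    exact h1

/-- A cycle vertex has only one tree neighbour, and at any other vertex all darts are tree darts, so
rotation preserves the value there. Walks in the tree do the rest. -/
theorem eq_of_tree_adj (h : IsTreeCycleUnion H T f) (hσ : IsRotationSystem σ)
    {s : H.Dart → ZMod 2} (hs : ∀ d, s (facePerm σ d) = s d)
    (hsymm : ∀ d : H.Dart, T.Adj d.fst d.snd → s d = s d.symm) (d d' : H.Dart)
    (hd : T.Adj d.fst d.snd) (hd' : T.Adj d'.fst d'.snd) : s d = s d' := by
  have hrot : ∀ d d' : H.Dart, T.Adj d.fst d.snd → T.Adj d'.fst d'.snd → d.fst = d'.fst →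
      s d = s d' := by
    intro d d' hd hd' hdd
    by_cases hleaf : ∃ i, d.fst = f i
    · obtain ⟨i, hi⟩ := hleaf
      rw [hi] at hd
      rw [← hdd, hi] at hd'
      exact congrArg s (SimpleGraph.Dart.ext _ _ (Prod.ext hdd (h.leaf_unique i _ _ hd hd')))
    · have hT : ∀ e : H.Dart, e.fst = d.fst → T.Adj e.fst e.snd := by
        intro e he
        refine ((h.adj_iff _ _).1 e.adj).resolve_right ?_
        rintro ⟨i, ⟨h1, -⟩ | ⟨h1, -⟩⟩ <;> exact hleaf ⟨_, he.symm.trans h1⟩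
      have hstep : ∀ e : H.Dart, e.fst = d.fst → s (σ e) = s e := fun e he =>
        (rotation_apply_eq hs e).trans (hsymm e (hT e he)).symm
      obtain ⟨i, rfl⟩ := hσ.2 d d' hdd
      have hfst : ∀ n : ℤ, ((σ ^ n) d).fst = d.fst := by
        intro n
        induction n with
        | zero => rfl
        | succ i ih => rw [add_comm, zpow_add, zpow_one, Equiv.Perm.mul_apply, hσ.1, ih]
        | pred i ih =>
          rw [← ih, ← hσ.1 ((σ ^ (-(i : ℤ) - 1)) d), ← Equiv.Perm.mul_apply, ← zpow_one_add]
          congr 4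
          ring
      clear hdd hd'
      induction i with
      | zero => rfl
      | succ i ih => rw [ih, add_comm, zpow_add, zpow_one, Equiv.Perm.mul_apply, hstep _ (hfst _)]
      | pred i ih =>
        rw [ih, ← hstep ((σ ^ (-(i : ℤ) - 1)) d) (hfst _), ← Equiv.Perm.mul_apply,
          ← zpow_one_add]
        congr 3
        ring
  suffices ∀ u v (_ : T.Walk u v) (d d' : H.Dart), T.Adj d.fst d.snd → T.Adj d'.fst d'.snd →
      d.fst = u → d'.fst = v → s d = s d' by
    obtain ⟨p⟩ := h.isTree.connected.preconnected d.fst d'.fst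
    exact this _ _ p d d' hd hd' rfl rfl
  intro u v p
  induction p with
  | nil => exact fun d d' hd hd' h h' => hrot d d' hd hd' (h.trans h'.symm)
  | cons huv p ih =>
    intro d d' hd hd' hu hv
    rw [hrot d ⟨(_, _), h.le huv⟩ hd huv hu, hsymm _ huv]
    exact ih _ _ huv.symm hd' rfl hv

/-- The faces of a rotation system. -/
abbrev Face (σ : Equiv.Perm H.Dart) : Type _ := Quotient (Equiv.Perm.SameCycle.setoid (facePerm σ))

theorem mk_facePerm (d : H.Dart) :
    (Quotient.mk _ (facePerm σ d) : Face σ) = Quotient.mk _ d :=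
  Quotient.sound (Equiv.Perm.SameCycle.symm ⟨1, by simp⟩)

/-- The jumps of a function on faces across the edges of the cycle. -/
def cycJump (h : IsTreeCycleUnion H T f) (σ : Equiv.Perm H.Dart) :
    (Face σ → ZMod 2) →ₗ[ZMod 2] (Fin (m + 3) → ZMod 2) where
  toFun s i := s (Quotient.mk _ (h.cycDart i)) + s (Quotient.mk _ (h.cycDart i).symm)
  map_add' s t := by
    ext i
    simp only [Pi.add_apply]
    ring
  map_smul' a s := by
    ext i
    simp [mul_add]

/-- Without jumps on the cycle there are none on the tree either, so only constants remain. -/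
theorem finrank_ker_cycJump_le [Finite V] (h : IsTreeCycleUnion H T f) (hσ : IsRotationSystem σ) :
    Module.finrank (ZMod 2) (LinearMap.ker (h.cycJump σ)) ≤ 1 := by
  classical
  have := Fintype.ofFinite V
  have hle : LinearMap.ker (h.cycJump σ) ≤ Submodule.span (ZMod 2) {fun _ => 1} := by
    intro s hs
    rw [LinearMap.mem_ker] at hs
    have hinv : ∀ d, (fun d => s (Quotient.mk _ d)) (facePerm σ d) =
        (fun d => s (Quotient.mk _ d)) d := fun d => congrArg s (mk_facePerm d)
    have hc : ∀ i, (fun d => s (Quotient.mk _ d)) (h.cycDart i) +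
        (fun d => s (Quotient.mk _ d)) (h.cycDart i).symm = 0 := fun i => congrFun hs i
    have hsymm : ∀ d, (fun d => s (Quotient.mk _ d)) d =
        (fun d => s (Quotient.mk _ d)) d.symm := by
      intro d
      rcases h.adj_or_eq_cycDart d with hd | ⟨i, rfl | rfl⟩
      · exact h.eq_symm_of_tree_adj hσ.1 (s := fun d => s (Quotient.mk _ d)) hinv hc d hd
      · exact CharTwo.add_eq_zero.1 (hc i)
      · rw [SimpleGraph.Dart.symm_symm]
        exact (CharTwo.add_eq_zero.1 (hc i)).symm
    rw [Submodule.mem_span_singleton]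
    refine ⟨s (Quotient.mk _ (h.cycDart 0)), ?_⟩
    ext q
    induction q using Quotient.inductionOn with
    | h d =>
      simp only [Pi.smul_apply, smul_eq_mul, mul_one]
      exact eq_of_forall_eq_symm hσ h.preconnected hinv hsymm _ _
  calc _ ≤ Module.finrank (ZMod 2) (Submodule.span (ZMod 2) {fun _ : Face σ => (1 : ZMod 2)}) :=
        Submodule.finrank_mono hle
    _ ≤ 1 := (finrank_span_le_card _).trans (by simp)

theorem finrank_range_cycJump [Finite V] (h : IsTreeCycleUnion H T f) (hσ : IsRotationSystem σ) :
    Nat.card (Face σ) ≤ Module.finrank (ZMod 2) (LinearMap.range (h.cycJump σ)) + 1 := by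
  classical
  have := Fintype.ofFinite V
  have := Fintype.ofFinite (Face σ)
  have h1 := (h.cycJump σ).finrank_range_add_finrank_ker
  have h2 := h.finrank_ker_cycJump_le hσ
  rw [Module.finrank_fintype_fun_eq_card, ← Nat.card_eq_fintype_card] at h1
  omega

/-- Together with `ncard_edgeSet` this is the Euler inequality `v - e + f ≤ 2`. It lets planarity of
the constructions follow from a lower bound on the number of faces. -/
theorem card_face_le [Finite V] (h : IsTreeCycleUnion H T f) (hσ : IsRotationSystem σ) :
    Nat.card (Face σ) ≤ m + 3 + 1 := by
  have h1 := h.finrank_range_cycJump hσ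
  have h2 := (LinearMap.range (h.cycJump σ)).finrank_le
  rw [Module.finrank_fintype_fun_eq_card, Fintype.card_fin] at h2
  omega

/-- If the rotation system has genus zero, then the faces can be coloured with two colours so that
exactly the edges of the cycle separate faces of different colours. -/
theorem exists_coloring [Finite V] (h : IsTreeCycleUnion H T f) (hσ : IsRotationSystem σ)
    (hcard : Nat.card (Face σ) = m + 3 + 1) :
    ∃ s : H.Dart → ZMod 2, (∀ d, s (facePerm σ d) = s d) ∧
      (∀ d, T.Adj d.fst d.snd → s d = 0) ∧
      ∀ i, s (h.cycDart i) + s (h.cycDart i).symm = 1 := by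
  classical
  have := Fintype.ofFinite V
  have hr := h.finrank_range_cycJump hσ
  -- With `m + 4` faces and a kernel of dimension at most one, the rank is the full `m + 3`; the
  -- colouring is a preimage of the constant 1.
  have hsurj : LinearMap.range (h.cycJump σ) = ⊤ := by
    apply Submodule.eq_top_of_finrank_eq
    have h2 := (LinearMap.range (h.cycJump σ)).finrank_le
    rw [Module.finrank_fintype_fun_eq_card, Fintype.card_fin] at h2 ⊢
    omega
  obtain ⟨t, ht⟩ := LinearMap.range_eq_top.1 hsurj (fun _ => 1)
  obtain ⟨t', hinv, hc⟩ : ∃ t' : H.Dart → ZMod 2, (∀ d, t' (facePerm σ d) = t' d) ∧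
      ∀ i, t' (h.cycDart i) + t' (h.cycDart i).symm = 1 :=
    ⟨fun d => t (Quotient.mk _ d), fun d => congrArg t (mk_facePerm d), fun i => congrFun ht i⟩
  have htree : ∀ d : H.Dart, T.Adj d.fst d.snd → t' d = t' d.symm :=
    h.eq_symm_of_tree_adj hσ.1 hinv hc
  have hconst := h.eq_of_tree_adj hσ hinv htree
  by_cases hex : ∃ d : H.Dart, T.Adj d.fst d.snd
  · obtain ⟨d₀, hd₀⟩ := hex
    -- Adding the common value on tree darts turns it into 0 without changing any jump.
    refine ⟨fun d => t' d + t' d₀, fun d => by simp only [hinv], fun d hd => ?_, fun i => ?_⟩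
    · simp only [hconst d d₀ hd hd₀]
      exact CharTwo.add_self_eq_zero _
    · rw [← hc i, add_add_add_comm, CharTwo.add_self_eq_zero, add_zero]
  · exact ⟨t', hinv, fun d hd => absurd ⟨d, hd⟩ hex, hc⟩

end IsTreeCycleUnion

end TreeCycleUnion

/-! ### The outer face and the number of inner darts -/

section TreeCycleUnion

variable {V : Type*} {m : ℕ}

@[elab_as_elim]
theorem Fin.add_one_induction {P : Fin (m + 3) → Prop} (zero : P 0)
    (add_one : ∀ i, P i → P (i + 1)) (i : Fin (m + 3)) : P i := by
  induction i using Fin.induction with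
  | zero => exact zero
  | succ i ih =>
    rw [← Fin.coeSucc_eq_succ]
    exact add_one _ ih

namespace IsTreeCycleUnion

variable {H T : SimpleGraph V} {f : Fin (m + 3) → V}

theorem cycDart_injective (h : IsTreeCycleUnion H T f) : Function.Injective h.cycDart := by
  intro i j hij
  exact h.injective (congrArg (fun d : H.Dart => d.fst) hij)

theorem cycDart_edge_injective (h : IsTreeCycleUnion H T f) :
    Function.Injective fun i => (h.cycDart i).edge := by
  intro i j hij
  rcases (SimpleGraph.dart_edge_eq_iff _ _).1 hij with h' | h'
  · exact h.cycDart_injective h'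
  · have h1 : i = j + 1 := h.injective (congrArg (fun d : H.Dart => d.fst) h')
    have h2 : i + 1 = j := h.injective (congrArg (fun d : H.Dart => d.snd) h')
    rw [h1] at h2
    exact absurd h2 (Fin.add_one_add_one_ne j)

theorem ncard_edgeSet [Finite V] (h : IsTreeCycleUnion H T f) :
    H.edgeSet.ncard + 1 = Nat.card V + (m + 3) := by
  have hset : H.edgeSet = T.edgeSet ∪ Set.range fun i => (h.cycDart i).edge := by
    ext e
    induction e using Sym2.ind with
    | _ u v =>
      rw [SimpleGraph.mem_edgeSet, Set.mem_union, SimpleGraph.mem_edgeSet, h.adj_iff]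
      refine or_congr_right ?_
      simp only [CycAdj, Set.mem_range, cycDart, SimpleGraph.Dart.edge_mk, Sym2.eq_iff]
      refine exists_congr fun i => ?_
      tauto
  have hdisj : Disjoint T.edgeSet (Set.range fun i => (h.cycDart i).edge) := by
    rw [Set.disjoint_right]
    rintro _ ⟨i, rfl⟩ hi
    exact h.not_adj_cycDart i hi
  rw [hset, Set.ncard_union_eq hdisj, Set.ncard_range_of_injective h.cycDart_edge_injective,
    Nat.card_eq_fintype_card, Fintype.card_fin]
  have := (SimpleGraph.isTree_iff_connected_and_card.1 h.isTree).2
  rw [Nat.card_coe_set_eq] at this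
  omega

variable {σ : Equiv.Perm H.Dart}

theorem zmod_two_cases (x : ZMod 2) : x = 0 ∨ x = 1 := by
  revert x
  decide

/-- Darts of colour 1 are cycle darts, and each cycle edge has exactly one. The face permutation
keeps the colour and cannot turn back, since the reversed dart has colour 0; hence it moves on to
the next cycle edge, and all these darts form one orbit. -/
theorem sameCycle_of_eq_one (h : IsTreeCycleUnion H T f) (hσ : ∀ d, (σ d).fst = d.fst)
    {s : H.Dart → ZMod 2} (hs : ∀ d, s (facePerm σ d) = s d)
    (hT : ∀ d : H.Dart, T.Adj d.fst d.snd → s d = 0)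
    (hc : ∀ i, s (h.cycDart i) + s (h.cycDart i).symm = 1) (d d' : H.Dart) (hd : s d = 1)
    (hd' : s d' = 1) : (facePerm σ).SameCycle d d' := by
  have hfst : ∀ d, (facePerm σ d).fst = d.snd := fun d => hσ d.symm
  have hcyc : ∀ d, s d = 1 → ∃ i, d = h.cycDart i ∨ d = (h.cycDart i).symm := by
    intro d hd
    refine (h.adj_or_eq_cycDart d).resolve_left fun hd' => ?_
    rw [hT d hd'] at hd
    exact absurd hd (by decide)
  have hfwd : ∀ i, s (h.cycDart i) = 1 → facePerm σ (h.cycDart i) = h.cycDart (i + 1) := by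
    intro i hi
    have h1 := hs (h.cycDart i)
    obtain ⟨j, hj | hj⟩ := hcyc _ (h1.trans hi)
    · have hf := hfst (h.cycDart i)
      rw [hj] at hf ⊢
      rw [h.injective hf]
    · have hf := hfst (h.cycDart i)
      rw [hj] at hf h1
      have hij : j = i := add_right_cancel (h.injective hf)
      have h2 := hc i
      rw [← hij, h1, ← hij] at h2
      rw [← hij] at hi
      rw [hi] at h2
      exact absurd h2 (by decide)
  have hbwd : ∀ i, s (h.cycDart (i + 1)).symm = 1 →
      facePerm σ (h.cycDart (i + 1)).symm = (h.cycDart i).symm := by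
    intro i hi
    have h1 := hs (h.cycDart (i + 1)).symm
    obtain ⟨j, hj | hj⟩ := hcyc _ (h1.trans hi)
    · have hf := hfst (h.cycDart (i + 1)).symm
      rw [hj] at hf h1
      have hij : j = i + 1 := h.injective hf
      have h2 := hc (i + 1)
      rw [← hij, h1, ← hij] at h2
      rw [← hij] at hi
      rw [hi] at h2
      exact absurd h2 (by decide)
    · have hf := hfst (h.cycDart (i + 1)).symm
      rw [hj] at hf ⊢
      rw [add_right_cancel (h.injective hf)]
  -- The colour of one cycle dart decides in which direction the outer face traverses the cycle.
  rcases zmod_two_cases (s (h.cycDart 0)) with h0 | h0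
  · have h0' : s (h.cycDart 0).symm = 1 := by
      have := hc 0
      rwa [h0, zero_add] at this
    have key : ∀ i, s (h.cycDart (-i)).symm = 1 ∧
        (facePerm σ).SameCycle (h.cycDart 0).symm (h.cycDart (-i)).symm := by
      intro i
      induction i using Fin.add_one_induction with
      | zero =>
        rw [neg_zero]
        exact ⟨h0', .refl _ _⟩
      | add_one i ih =>
        have hn : -(i + 1) + 1 = -i := by abel
        have hst := hbwd (-(i + 1)) (by rw [hn]; exact ih.1)
        rw [hn] at hst
        rw [← hst, hs]
        exact ⟨ih.1, ih.2.trans ⟨1, by simp⟩⟩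
    have key' : ∀ i, s (h.cycDart i).symm = 1 ∧
        (facePerm σ).SameCycle (h.cycDart 0).symm (h.cycDart i).symm := by
      intro i
      have := key (-i)
      rwa [neg_neg] at this
    have key2 : ∀ d, s d = 1 → (facePerm σ).SameCycle (h.cycDart 0).symm d := by
      intro d hd
      obtain ⟨i, rfl | rfl⟩ := hcyc d hd
      · have := hc i
        rw [hd, (key' i).1] at this
        exact absurd this (by decide)
      · exact (key' i).2
    exact (key2 d hd).symm.trans (key2 d' hd')
  · have key' : ∀ i, s (h.cycDart i) = 1 ∧
        (facePerm σ).SameCycle (h.cycDart 0) (h.cycDart i) := by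
      intro i
      induction i using Fin.add_one_induction with
      | zero => exact ⟨h0, .refl _ _⟩
      | add_one i ih =>
        rw [← hfwd _ ih.1, hs]
        exact ⟨ih.1, ih.2.trans ⟨1, by simp⟩⟩
    have key2 : ∀ d, s d = 1 → (facePerm σ).SameCycle (h.cycDart 0) d := by
      intro d hd
      obtain ⟨i, rfl | rfl⟩ := hcyc d hd
      · exact (key' i).2
      · have := hc i
        rw [hd, (key' i).1] at this
        exact absurd this (by decide)
    exact (key2 d hd).symm.trans (key2 d' hd')

-- Each edge has two darts, and every cycle edge gives up one of them to the outer colour.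
open Finset in
open Classical in
theorem card_eq_zero_add [Fintype V] (h : IsTreeCycleUnion H T f) {s : H.Dart → ZMod 2}
    (hc : ∀ i, s (h.cycDart i) + s (h.cycDart i).symm = 1) :
    #{d : H.Dart | s d = 0} + 2 ≤ 2 * Nat.card V + (m + 3) := by
  have h1 : Fintype.card H.Dart = 2 * #H.edgeFinset := H.dart_card_eq_twice_card_edges
  have h2 := h.ncard_edgeSet
  rw [← SimpleGraph.coe_edgeFinset, Set.ncard_coe_finset] at h2
  have h3 : #{d : H.Dart | s d = 0} + #{d : H.Dart | s d ≠ 0} = Fintype.card H.Dart := by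
    rw [card_filter_add_card_filter_not, card_univ]
  have h4 : m + 3 ≤ #{d : H.Dart | s d ≠ 0} := by
    have : #(univ : Finset (Fin (m + 3))) ≤ #{d : H.Dart | s d ≠ 0} := by
      refine card_le_card_of_injOn
        (fun i => if s (h.cycDart i) = 0 then (h.cycDart i).symm else h.cycDart i) ?_ ?_
      · intro i _
        simp only [coe_filter, mem_univ, true_and, Set.mem_ofPred_eq]
        split_ifs with hi
        · have := hc i
          rw [hi, zero_add] at this
          rw [this]
          decide
        · exact hi
      · intro i _ j _ hij
        refine h.cycDart_edge_injective ?_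
        have := congrArg SimpleGraph.Dart.edge hij
        simp only at this
        split_ifs at this <;> simpa using this
    simpa using this
  omega

end IsTreeCycleUnion

end TreeCycleUnion

/-! ### Face lengths and the bound on the number of leaves -/

section TreeCycleUnion

variable {V : Type*} {m : ℕ}

namespace IsTreeCycleUnion

variable {H T : SimpleGraph V} {f : Fin (m + 3) → V} {σ : Equiv.Perm H.Dart}

/-- This is what prevents face walks from backtracking. -/
theorem rotation_ne (hσ : IsRotationSystem σ) (hdeg : ∀ u v, H.Adj u v → ∃ w, w ≠ v ∧ H.Adj u w)
    (d : H.Dart) : σ d ≠ d := by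
  intro hd
  obtain ⟨w, hw, hadj⟩ := hdeg _ _ d.adj
  obtain ⟨i, hi⟩ := hσ.2 d ⟨(d.fst, w), hadj⟩ rfl
  rw [Equiv.Perm.zpow_apply_eq_self_of_apply_eq_self hd] at hi
  exact hw (congrArg (fun d : H.Dart => d.snd) hi).symm

theorem facePerm_ne_symm (hσ : ∀ d, σ d ≠ d) (d : H.Dart) : facePerm σ d ≠ d.symm := hσ d.symm

open Finset in
open Classical in
/-- A face is a triangle or has length at least five. -/
theorem five_le_card_face [Fintype V] (hσ : ∀ d, (σ d).fst = d.fst) (hne : ∀ d, σ d ≠ d)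
    (hC4 : ∀ a b c e, H.Adj a b → H.Adj b c → H.Adj c e → H.Adj e a → a ≠ c → b ≠ e → False)
    (d : H.Dart) :
    3 ≤ #{x : H.Dart | (Quotient.mk _ x : Face σ) = Quotient.mk _ d} ∧
    (facePerm σ (facePerm σ (facePerm σ d)) = d ∨
      5 ≤ #{x : H.Dart | (Quotient.mk _ x : Face σ) = Quotient.mk _ d}) := by
  set φ := facePerm σ with hφ
  have hfst : ∀ x, (φ x).fst = x.snd := fun x => hσ x.symm
  have h1 : ∀ x, φ x ≠ x := by
    intro x hx
    exact x.snd_ne_fst (by rw [← hfst, hx])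
  have h2 : ∀ x, φ (φ x) ≠ x := by
    intro x hx
    refine facePerm_ne_symm hne x (SimpleGraph.Dart.ext _ _ (Prod.ext (hfst x) ?_))
    exact (hfst (φ x)).symm.trans (by rw [hx]; rfl)
  have h2' : ∀ x : H.Dart, x.fst ≠ (φ x).snd := by
    intro x hx
    exact facePerm_ne_symm hne x (SimpleGraph.Dart.ext _ _ (Prod.ext (hfst x) hx.symm))
  -- A closed walk of length four that never backtracks is a 4-cycle.
  have h4 : ∀ x, φ (φ (φ (φ x))) ≠ x := by
    intro x hx
    refine hC4 x.fst (φ x).fst (φ (φ x)).fst (φ (φ (φ x))).fst ?_ ?_ ?_ ?_ ?_ ?_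
    · rw [hfst]; exact x.adj
    · rw [hfst (φ x)]; exact (φ x).adj
    · rw [hfst (φ (φ x))]; exact (φ (φ x)).adj
    · have h := (φ (φ (φ x))).adj
      rwa [← hfst (φ (φ (φ x))), hx] at h
    · rw [hfst (φ x)]; exact h2' x
    · rw [hfst (φ (φ x))]; exact h2' (φ x)
  have hmk : ∀ x, (Quotient.mk _ (φ x) : Face σ) = Quotient.mk _ x := mk_facePerm
  constructor
  · have hsub : ({d, φ d, φ (φ d)} : Finset H.Dart) ⊆
        univ.filter fun x : H.Dart => (Quotient.mk _ x : Face σ) = Quotient.mk _ d := by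
      intro x hx
      simp only [mem_insert, mem_singleton] at hx
      simp only [mem_filter, mem_univ, true_and]
      rcases hx with rfl | rfl | rfl <;> simp only [hmk]
    refine le_trans (le_of_eq ?_) (card_le_card hsub)
    rw [card_insert_of_notMem, card_pair (h1 _).symm]
    simp only [mem_insert, mem_singleton, not_or]
    exact ⟨(h1 _).symm, (h2 _).symm⟩
  · refine or_iff_not_imp_left.2 fun h3 => ?_
    have h3' : φ (φ (φ (φ d))) ≠ φ d := fun h => h3 (φ.injective h)
    have hsub : ({d, φ d, φ (φ d), φ (φ (φ d)), φ (φ (φ (φ d)))} : Finset H.Dart) ⊆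
        univ.filter fun x : H.Dart => (Quotient.mk _ x : Face σ) = Quotient.mk _ d := by
      intro x hx
      simp only [mem_insert, mem_singleton] at hx
      simp only [mem_filter, mem_univ, true_and]
      rcases hx with rfl | rfl | rfl | rfl | rfl <;> simp only [hmk]
    refine le_trans (le_of_eq ?_) (card_le_card hsub)
    rw [card_insert_of_notMem, card_insert_of_notMem, card_insert_of_notMem,
      card_pair (h1 _).symm]
    · simp only [mem_insert, mem_singleton, not_or]
      exact ⟨(h1 _).symm, (h2 _).symm⟩
    · simp only [mem_insert, mem_singleton, not_or]
      exact ⟨(h1 _).symm, (h2 _).symm, h3'.symm⟩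
    · simp only [mem_insert, mem_singleton, not_or]
      exact ⟨(h1 _).symm, (h2 _).symm, fun h => h3 h.symm, (h4 _).symm⟩

theorem mem_range_of_cycAdj {u v : V} (huv : CycAdj f u v) : ∃ i, v = f i := by
  obtain ⟨i, ⟨-, h⟩ | ⟨-, h⟩⟩ := huv <;> exact ⟨_, h⟩

theorem cycAdj_iff (hf : Function.Injective f) (i j : Fin (m + 3)) :
    CycAdj f (f i) (f j) ↔ j = i + 1 ∨ i = j + 1 := by
  constructor
  · rintro ⟨l, ⟨h1, h2⟩ | ⟨h1, h2⟩⟩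
    · exact Or.inl (by rw [hf h1, hf h2])
    · exact Or.inr (by rw [hf h1, hf h2])
  · rintro (rfl | rfl)
    · exact ⟨i, Or.inl ⟨rfl, rfl⟩⟩
    · exact ⟨j, Or.inr ⟨rfl, rfl⟩⟩

theorem adj_leaves_iff (h : IsTreeCycleUnion H T f) (i j : Fin (m + 3)) :
    H.Adj (f i) (f j) ↔ j = i + 1 ∨ i = j + 1 := by
  rw [h.adj_iff, cycAdj_iff h.injective]
  exact or_iff_right (h.leaf_not_adj i j)

theorem add_three_ne (hm : m ≠ 0) (i : Fin (m + 3)) : i + 1 + 1 + 1 ≠ i := by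
  intro h
  have h2 : (1 + 1 + 1 : Fin (m + 3)) = 0 := by
    rw [add_assoc, add_assoc] at h
    simpa [add_assoc] using h
  have := congrArg Fin.val h2
  obtain ⟨m, rfl⟩ := Nat.exists_eq_succ_of_ne_zero hm
  simp [Fin.val_add, Nat.mod_eq_of_lt] at this

/-- The third vertex of a triangle on an edge of the cycle is the common parent of its ends. -/
theorem tree_adj_of_triangle (h : IsTreeCycleUnion H T f) (hm : m ≠ 0) (i : Fin (m + 3)) (w : V)
    (h1 : H.Adj (f i) w) (h2 : H.Adj (f (i + 1)) w) : T.Adj (f i) w ∧ T.Adj (f (i + 1)) w := by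
  by_cases hw : ∃ j, w = f j
  · obtain ⟨j, rfl⟩ := hw
    -- Consecutive cycle vertices have a common neighbour on the cycle only if the cycle is a
    -- triangle, which `hm` excludes.
    rw [h.adj_leaves_iff] at h1 h2
    exfalso
    rcases h1 with rfl | rfl
    · simp at h2
    · rcases h2 with h2 | h2
      · exact add_three_ne hm j h2.symm
      · simp at h2
  · exact ⟨((h.adj_iff _ _).1 h1).resolve_right fun h' => hw (mem_range_of_cycAdj h'),
      ((h.adj_iff _ _).1 h2).resolve_right fun h' => hw (mem_range_of_cycAdj h')⟩

theorem _root_.SimpleGraph.IsAcyclic.not_triangle (hT : T.IsAcyclic) {a b c : V}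
    (h1 : T.Adj a b) (h2 : T.Adj b c) (h3 : T.Adj c a) : False := by
  classical
  refine hT.cliqueFree (n := 3) le_rfl {a, b, c} ?_
  rw [SimpleGraph.is3Clique_triple_iff]
  exact ⟨h1, h3.symm, h2⟩

-- If two consecutive cycle edges both had a common parent, it would be the same vertex, and it
-- would close a 4-cycle with the three leaves. So the set of such edges is disjoint from its shift
-- by one.
open Finset in
open Classical in
theorem card_common_parent_le (h : IsTreeCycleUnion H T f)
    (hC4 : ∀ a b c e, H.Adj a b → H.Adj b c → H.Adj c e → H.Adj e a → a ≠ c → b ≠ e → False) :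
    2 * #{i : Fin (m + 3) | ∃ w, T.Adj (f i) w ∧ T.Adj (f (i + 1)) w} ≤ m + 3 := by
  set I : Finset (Fin (m + 3)) := {i | ∃ w, T.Adj (f i) w ∧ T.Adj (f (i + 1)) w} with hI
  have hdisj : Disjoint I (I.image fun i => i + 1) := by
    rw [disjoint_left]
    intro j hj hj'
    obtain ⟨i, hi, rfl⟩ := mem_image.1 hj'
    simp only [hI, mem_filter, mem_univ, true_and] at hi hj
    obtain ⟨w, hw1, hw2⟩ := hi
    obtain ⟨w', hw1', hw2'⟩ := hj
    obtain rfl := h.leaf_unique _ _ _ hw2 hw1'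
    refine hC4 (f i) (f (i + 1)) (f (i + 1 + 1)) w ((h.adj_leaves_iff _ _).2 (Or.inl rfl))
      ((h.adj_leaves_iff _ _).2 (Or.inl rfl)) (h.le hw2') (h.le hw1).symm ?_ hw2.ne
    exact fun h' => Fin.add_one_add_one_ne i (h.injective h').symm
  have hcard := card_le_univ (I ∪ I.image fun i => i + 1)
  rw [card_union_of_disjoint hdisj, card_image_of_injective _ (add_left_injective 1),
    Fintype.card_fin] at hcard
  omega

open Finset in
open Classical in
/-- A genus zero graph that is the union of a tree and a cycle through leaves, without vertices of
degree one and without four-cycles, has few leaves. -/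
theorem three_mul_le [Fintype V] (h : IsTreeCycleUnion H T f) (hm : m ≠ 0)
    (hσ : IsRotationSystem σ) (hcard : Nat.card (Face σ) = m + 3 + 1)
    (hdeg : ∀ u v, H.Adj u v → ∃ w, w ≠ v ∧ H.Adj u w)
    (hC4 : ∀ a b c e, H.Adj a b → H.Adj b c → H.Adj c e → H.Adj e a → a ≠ c → b ≠ e → False) :
    3 * (m + 3) + 2 ≤ 2 * Nat.card V := by
  obtain ⟨s, hs, hT, hc⟩ := h.exists_coloring hσ hcard
  have hne := rotation_ne hσ hdeg
  have hresp : ∀ a b, (facePerm σ).SameCycle a b → s a = s b := by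
    rintro a _ ⟨i, rfl⟩
    induction i with
    | zero => rfl
    | succ i ih => rw [ih, add_comm, zpow_add, zpow_one, Equiv.Perm.mul_apply, hs]
    | pred i ih =>
      rw [ih, ← hs ((facePerm σ ^ (-(i : ℤ) - 1)) a), ← Equiv.Perm.mul_apply, ← zpow_one_add]
      congr 3
      ring
  have := Fintype.ofFinite (Face σ)
  let t : Face σ → ZMod 2 := Quotient.lift s hresp
  have htmk : ∀ d, t (Quotient.mk _ d) = s d := fun d => rfl
  set F₀ : Finset (Face σ) := {q | t q = 0} with hF₀
  have houter : #{q : Face σ | ¬ t q = 0} ≤ 1 := by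
    rw [card_le_one]
    intro a ha b hb
    induction a using Quotient.inductionOn with
    | h d =>
    induction b using Quotient.inductionOn with
    | h d' =>
      simp only [mem_filter, mem_univ, true_and, htmk] at ha hb
      exact Quotient.sound (h.sameCycle_of_eq_one hσ.1 hs hT hc d d'
        ((zmod_two_cases _).resolve_left ha) ((zmod_two_cases _).resolve_left hb))
  have hinner : m + 3 ≤ #F₀ := by
    have h1 : #F₀ + #{q : Face σ | ¬ t q = 0} = m + 3 + 1 := by
      rw [← hcard, Nat.card_eq_fintype_card, ← card_univ]
      convert card_filter_add_card_filter_not (s := univ) (fun q : Face σ => t q = 0)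
    omega
  set I : Finset (Fin (m + 3)) := {i | ∃ w, T.Adj (f i) w ∧ T.Adj (f (i + 1)) w} with hI
  have hIcard : 2 * #I ≤ m + 3 := by convert h.card_common_parent_le hC4
  let inner : Fin (m + 3) → H.Dart := fun i =>
    if s (h.cycDart i) = 0 then h.cycDart i else (h.cycDart i).symm
  have hinner_eq : ∀ d, s d = 0 → ¬ T.Adj d.fst d.snd →
      ∃ i, d = inner i ∧ (d = h.cycDart i ∨ d = (h.cycDart i).symm) := by
    intro d hd hd'
    obtain ⟨i, hi⟩ := (h.adj_or_eq_cycDart d).resolve_left hd'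
    refine ⟨i, ?_, hi⟩
    rcases hi with rfl | rfl
    · simp only [inner, if_pos hd]
    · have := hc i
      rw [hd, add_zero] at this
      simp only [inner, this, one_ne_zero, if_false]
  set B : Finset (Face σ) := I.image fun i => Quotient.mk _ (inner i) with hB
  -- `B` consists of the inner faces at cycle edges with a common parent. A triangle falls short of
  -- length five by 2 and always belongs to `B`.
  have hfib : ∀ q ∈ F₀, 5 ≤ #{x : H.Dart | (Quotient.mk _ x : Face σ) = q} +
      if q ∈ B then 2 else 0 := by
    intro q hq
    induction q using Quotient.inductionOn with
    | h d =>
      simp only [hF₀, mem_filter, mem_univ, true_and, htmk] at hq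
      obtain ⟨h3, htri | h5⟩ := five_le_card_face hσ.1 hne hC4 d
      · have hmemB : (Quotient.mk _ d : Face σ) ∈ B := by
          have key : ∀ x : H.Dart, s x = 0 → facePerm σ (facePerm σ (facePerm σ x)) = x →
              ¬ T.Adj x.fst x.snd → (Quotient.mk _ x : Face σ) ∈ B := by
            intro x hx hx3 hxT
            obtain ⟨i, hi, hi'⟩ := hinner_eq x hx hxT
            have hadj1 := (facePerm σ x).adj
            have hadj2 := (facePerm σ (facePerm σ x)).adj
            have e1 : (facePerm σ x).fst = x.snd := hσ.1 x.symm
            have e2 : (facePerm σ (facePerm σ x)).fst = (facePerm σ x).snd :=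
              hσ.1 (facePerm σ x).symm
            have e3 : x.fst = (facePerm σ (facePerm σ x)).snd :=
              (congrArg (fun d : H.Dart => d.fst) hx3.symm).trans
                (hσ.1 (facePerm σ (facePerm σ x)).symm)
            rw [e2, ← e3] at hadj2
            rw [e1] at hadj1
            refine mem_image.2 ⟨i, ?_, by rw [← hi]⟩
            simp only [hI, mem_filter, mem_univ, true_and]
            refine ⟨(facePerm σ x).snd, ?_⟩
            rcases hi' with h' | h'
            · refine h.tree_adj_of_triangle hm i _ ?_ ?_
              · have : x.fst = f i := by rw [h']; rfl
                rw [← this]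
                exact hadj2.symm
              · have : x.snd = f (i + 1) := by rw [h']; rfl
                rw [← this]
                exact hadj1
            · refine h.tree_adj_of_triangle hm i _ ?_ ?_
              · have : x.snd = f i := by rw [h']; rfl
                rw [← this]
                exact hadj1
              · have : x.fst = f (i + 1) := by rw [h']; rfl
                rw [← this]
                exact hadj2.symm
          -- The three sides cannot all lie in the tree; `key` is applied to the first one that does
          -- not.
          by_cases hd0 : T.Adj d.fst d.snd
          · by_cases hd1 : T.Adj (facePerm σ d).fst (facePerm σ d).snd
            · by_cases hd2 : T.Adj (facePerm σ (facePerm σ d)).fst (facePerm σ (facePerm σ d)).snd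
              · exfalso
                have e1 : (facePerm σ d).fst = d.snd := hσ.1 d.symm
                have e2 : (facePerm σ (facePerm σ d)).fst = (facePerm σ d).snd :=
                  hσ.1 (facePerm σ d).symm
                have e3 : d.fst = (facePerm σ (facePerm σ d)).snd :=
                  (congrArg (fun d : H.Dart => d.fst) htri.symm).trans
                    (hσ.1 (facePerm σ (facePerm σ d)).symm)
                rw [e1] at hd1
                rw [e2, ← e3] at hd2
                exact h.isTree.isAcyclic.not_triangle hd0 hd1 hd2
              · have := key _ (by rw [hs, hs, hq]) (by rw [htri]) hd2
                rwa [mk_facePerm, mk_facePerm] at this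
            · have := key _ (by rw [hs, hq]) (by rw [htri]) hd1
              rwa [mk_facePerm] at this
          · exact key _ hq htri hd0
        rw [if_pos hmemB]
        omega
      · omega
  have hsum : ∑ q ∈ F₀, #{x : H.Dart | (Quotient.mk _ x : Face σ) = q} =
      #{d : H.Dart | s d = 0} := by
    rw [card_eq_sum_card_fiberwise (f := fun d => (Quotient.mk _ d : Face σ)) (t := F₀)]
    · refine sum_congr rfl fun q hq => ?_
      congr 1
      ext x
      simp only [mem_filter, mem_univ, true_and, iff_and_self]
      rintro rfl
      rw [← htmk]
      simpa only [hF₀, mem_filter, mem_univ, true_and] using hq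
    · intro d hd
      simpa [hF₀, htmk] using hd
  have hbad : ∑ q ∈ F₀, (if q ∈ B then 2 else 0) ≤ m + 3 := by
    rw [← sum_filter, sum_const, smul_eq_mul]
    have h1 : #{q ∈ F₀ | q ∈ B} ≤ #I :=
      (card_le_card fun q hq => (mem_filter.1 hq).2).trans card_image_le
    omega
  have htotal := sum_le_sum hfib
  -- This gives `5(m + 3) ≤ (2n + (m + 3) - 2) + (m + 3)`.
  rw [sum_const, sum_add_distrib, hsum, smul_eq_mul] at htotal
  have hzero := h.card_eq_zero_add hc
  omega

end IsTreeCycleUnion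

end TreeCycleUnion

/-! ### From Halin graphs to tree-cycle unions -/

theorem SimpleGraph.cycleGraph_four_free_iff {V : Type*} {H : SimpleGraph V} :
    (SimpleGraph.cycleGraph 4).Free H ↔ ∀ a b c e, H.Adj a b → H.Adj b c → H.Adj c e →
      H.Adj e a → a ≠ c → b ≠ e → False := by
  constructor
  · intro h a b c e hab hbc hce hea hac hbe
    refine h ⟨⟨⟨![a, b, c, e], ?_⟩, ?_⟩⟩
    · intro x y hxy
      fin_cases x <;> fin_cases y <;>
        first
        | exact absurd hxy (by decide)
        | simp [hab, hbc, hce, hea, hab.symm, hbc.symm, hce.symm, hea.symm]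
    · intro x y hxy
      fin_cases x <;> fin_cases y <;>
        simp [hab.ne, hbc.ne, hce.ne, hea.ne, hab.ne', hbc.ne', hce.ne', hea.ne', hac, hbe, hac.symm,
          hbe.symm] at hxy ⊢
  · rintro h ⟨φ⟩
    refine h (φ 0) (φ 1) (φ 2) (φ 3) ?_ ?_ ?_ ?_ ?_ ?_
    · exact φ.toHom.map_adj (by decide)
    · exact φ.toHom.map_adj (by decide)
    · exact φ.toHom.map_adj (by decide)
    · exact φ.toHom.map_adj (by decide)
    · exact φ.injective.ne (by decide)
    · exact φ.injective.ne (by decide)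

theorem Fin.exists_ne_ne {m : ℕ} (i j : Fin (m + 3)) : ∃ l, l ≠ i ∧ l ≠ j := by
  have h : ({i, j} : Finset (Fin (m + 3))).card < Fintype.card (Fin (m + 3)) := by
    rw [Fintype.card_fin]
    have := Finset.card_le_two (a := i) (b := j)
    omega
  obtain ⟨l, hl⟩ := Finset.exists_mem_notMem_of_card_lt_card
    (h.trans_eq (Finset.card_univ (α := Fin (m + 3))).symm)
  simp only [Finset.mem_insert, Finset.mem_singleton, not_or] at hl
  exact ⟨l, hl.2⟩

section

variable {V : Type*} {T : SimpleGraph V} {m : ℕ}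

theorem eq_of_mem_leafSet {u v w : V} (hu : u ∈ leafSet T) (hv : T.Adj u v) (hw : T.Adj u w) :
    v = w := by
  obtain ⟨x, hx⟩ := Set.ncard_eq_one.1 hu
  have h1 : v ∈ T.neighborSet u := hv
  have h2 : w ∈ T.neighborSet u := hw
  rw [hx, Set.mem_singleton_iff] at h1 h2
  rw [h1, h2]

theorem isTreeCycleUnion_of_leafSet (hT : T.IsTree) (f : Fin (m + 3) ↪ V)
    (hf : Set.range f = leafSet T) :
    IsTreeCycleUnion (T ⊔ (SimpleGraph.cycleGraph (m + 3)).map f) T f where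
  isTree := hT
  injective := f.injective
  adj_iff u v := by rw [SimpleGraph.sup_adj, map_cycleGraph_adj]
  leaf_unique i v w := eq_of_mem_leafSet (hf ▸ Set.mem_range_self i)
  leaf_not_adj i j hij := by
    have hi : f i ∈ leafSet T := hf ▸ Set.mem_range_self i
    have hj : f j ∈ leafSet T := hf ▸ Set.mem_range_self j
    obtain ⟨l, hli, hlj⟩ := Fin.exists_ne_ne i j
    -- Two adjacent leaves form a whole component, so the third leaf `f l` would be unreachable.
    have key : ∀ u v (_ : T.Walk u v), (u = f i ∨ u = f j) → v = f i ∨ v = f j := by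
      intro u v p
      induction p with
      | nil => exact id
      | cons h p ih =>
        rintro (rfl | rfl)
        · exact ih (Or.inr (eq_of_mem_leafSet hi h hij))
        · exact ih (Or.inl (eq_of_mem_leafSet hj h hij.symm))
    obtain ⟨p⟩ := hT.connected.preconnected (f i) (f l)
    rcases key _ _ p (Or.inl rfl) with h | h
    · exact hli (f.injective h)
    · exact hlj (f.injective h)

theorem IsTreeCycleUnion.numFaces_eq {H : SimpleGraph V} {f : Fin (m + 3) → V}
    (h : IsTreeCycleUnion H T f) (σ : Equiv.Perm H.Dart) :
    numFaces σ = Nat.card (IsTreeCycleUnion.Face σ) := by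
  have hset : {v : V | ∀ w, ¬ H.Adj v w} = ∅ := by
    rw [Set.eq_empty_iff_forall_notMem]
    intro v hv
    have : Nontrivial V := ⟨f 0, f 1, h.injective.ne (by simp)⟩
    obtain ⟨w, hw⟩ := h.preconnected.exists_adj_of_nontrivial v
    exact hv w hw
  rw [numFaces, hset, Set.ncard_empty, add_zero]

theorem IsTreeCycleUnion.card_connectedComponent {H : SimpleGraph V} {f : Fin (m + 3) → V}
    (h : IsTreeCycleUnion H T f) : Nat.card H.ConnectedComponent = 1 := by
  have : Subsingleton H.ConnectedComponent := h.preconnected.subsingleton_connectedComponent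
  have : Nonempty H.ConnectedComponent := ⟨H.connectedComponentMk (f 0)⟩
  exact Nat.card_unique

/-- Planarity of a tree-cycle union: some rotation system has one more face than there are edges in
the cycle. -/
theorem IsTreeCycleUnion.isPlanarGraph_iff [Finite V] {H : SimpleGraph V} {f : Fin (m + 3) → V}
    (h : IsTreeCycleUnion H T f) : IsPlanarGraph H ↔
      ∃ σ : Equiv.Perm H.Dart, IsRotationSystem σ ∧
        Nat.card (IsTreeCycleUnion.Face σ) = m + 3 + 1 := by
  refine exists_congr fun σ => and_congr_right fun _ => ?_
  rw [h.numFaces_eq, h.card_connectedComponent]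
  have := h.ncard_edgeSet
  omega

/-- The number of edges of a Halin graph without four-cycles. -/
theorem IsHalinGraph.exists_ncard_edgeSet [Finite V] {H : SimpleGraph V} (h : IsHalinGraph H)
    (hV : 6 ≤ Nat.card V) (hfree : (SimpleGraph.cycleGraph 4).Free H) :
    ∃ k, H.edgeSet.ncard + 1 = Nat.card V + k ∧ 3 * k + 2 ≤ 2 * Nat.card V := by
  obtain ⟨T, C, hT, hdeg, ⟨k, hk, f, hf, rfl⟩, -, rfl, hplanar⟩ := h
  obtain ⟨m, rfl⟩ := Nat.exists_eq_add_of_le' hk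
  have := Fintype.ofFinite V
  have hU := isTreeCycleUnion_of_leafSet hT f hf
  refine ⟨m + 3, hU.ncard_edgeSet, ?_⟩
  obtain ⟨σ, hσ, hcard⟩ := hU.isPlanarGraph_iff.1 hplanar
  -- With three leaves the triangle argument fails, but the bound reads `11 ≤ 2n` and follows from
  -- `hV`.
  by_cases hm : m = 0
  · omega
  refine hU.three_mul_le hm hσ hcard ?_ (SimpleGraph.cycleGraph_four_free_iff.1 hfree)
  intro u v _
  by_cases hu : u ∈ leafSet T
  · obtain ⟨i, rfl⟩ : u ∈ Set.range f := hf ▸ hu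
    have h1 : f (i + 1) ≠ f (i - 1) := by
      intro h'
      apply Fin.add_one_add_one_ne i
      rw [f.injective h']
      simp
    by_cases hv : f (i + 1) = v
    · exact ⟨f (i - 1), hv ▸ h1.symm, (hU.adj_leaves_iff _ _).2 (Or.inr (by simp))⟩
    · exact ⟨f (i + 1), hv, (hU.adj_leaves_iff _ _).2 (Or.inl rfl)⟩
  · obtain ⟨w, hw, hwv⟩ := Set.exists_ne_of_one_lt_ncard
      (lt_of_lt_of_le (by norm_num) (hdeg u hu) : 1 < (T.neighborSet u).ncard) v
    exact ⟨w, hwv, hU.le hw⟩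

end

/-! ### A local criterion for the absence of 4-cycles -/

section

variable {V : Type*} {m : ℕ}

namespace IsTreeCycleUnion

variable {H T : SimpleGraph V} {f : Fin (m + 3) → V}

theorem adj_leaf_iff (h : IsTreeCycleUnion H T f) {p : Fin (m + 3) → V}
    (hp : ∀ i, T.Adj (f i) (p i)) (i : Fin (m + 3)) (x : V) :
    H.Adj (f i) x ↔ x = p i ∨ x = f (i + 1) ∨ x = f (i - 1) := by
  constructor
  · intro hx
    by_cases hl : ∃ j, x = f j
    · obtain ⟨j, rfl⟩ := hl
      rcases (h.adj_leaves_iff _ _).1 hx with rfl | rfl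
      · exact Or.inr (Or.inl rfl)
      · exact Or.inr (Or.inr (by simp))
    · refine Or.inl (h.leaf_unique i _ _ (((h.adj_iff _ _).1 hx).resolve_right ?_) (hp i))
      exact fun h' => hl (mem_range_of_cycAdj h')
  · rintro (rfl | rfl | rfl)
    · exact h.le (hp i)
    · exact (h.adj_leaves_iff _ _).2 (Or.inl rfl)
    · exact (h.adj_leaves_iff _ _).2 (Or.inr (by simp))

theorem tree_adj_of_ne (h : IsTreeCycleUnion H T f) {x y : V} (hxy : H.Adj x y)
    (hx : ∀ i, x ≠ f i) : T.Adj x y := by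
  refine ((h.adj_iff _ _).1 hxy).resolve_right ?_
  rintro ⟨i, ⟨h', -⟩ | ⟨h', -⟩⟩ <;> exact hx _ h'

/-- Parents of consecutive leaves are not adjacent and leaves at distance two along the cycle have
distinct parents: then there are no four-cycles. -/
theorem cycleGraph_four_free (h : IsTreeCycleUnion H T f) (hm : 2 ≤ m) {p : Fin (m + 3) → V}
    (hp : ∀ i, T.Adj (f i) (p i)) (h1 : ∀ i, ¬ T.Adj (p i) (p (i + 1)))
    (h2 : ∀ i, p i ≠ p (i + 1 + 1)) : (SimpleGraph.cycleGraph 4).Free H := by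
  have hpl : ∀ i j, p i ≠ f j := fun i j hij => h.leaf_not_adj i j (hij ▸ hp i)
  -- The cycle itself must not have length four.
  have h4 : ∀ i : Fin (m + 3), i + 1 + 1 + 1 + 1 ≠ i := by
    intro i h
    have h2 : (1 + 1 + 1 + 1 : Fin (m + 3)) = 0 := by
      rw [add_assoc, add_assoc, add_assoc] at h
      simpa [add_assoc] using h
    have := congrArg Fin.val h2
    obtain ⟨m, rfl⟩ := Nat.exists_eq_add_of_le' hm
    simp [Fin.val_add, Nat.mod_eq_of_lt] at this
  have h2' : ∀ i, p (i - 1) ≠ p (i + 1) := by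
    intro i
    have := h2 (i - 1)
    rwa [sub_add_cancel] at this
  have h1' : ∀ i, ¬ T.Adj (p i) (p (i - 1)) := by
    intro i hi
    refine h1 (i - 1) ?_
    rw [sub_add_cancel]
    exact hi.symm
  have hpadj : ∀ i j, H.Adj (p i) (f j) → p i = p j := fun i j hij =>
    h.leaf_unique j _ _ (h.tree_adj_of_ne hij (hpl i)).symm (hp j)
  -- A 4-cycle through `f i` uses two of its three neighbours `p i`, `f (i + 1)`, `f (i - 1)`. Each
  -- of the three pairs is refuted by showing that it has no common neighbour but `f i`.
  have key1 : ∀ i c, c ≠ f i → H.Adj (f (i + 1)) c → H.Adj (f (i - 1)) c → False := by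
    intro i c hc hb he
    rcases (h.adj_leaf_iff hp _ _).1 hb with rfl | rfl | rfl
    · rcases (h.adj_leaf_iff hp _ _).1 he with h' | h' | h'
      · exact h2' i h'.symm
      · exact hpl _ _ h'
      · exact hpl _ _ h'
    · rcases (h.adj_leaf_iff hp _ _).1 he with h' | h' | h'
      · exact hpl _ _ h'.symm
      · rw [sub_add_cancel] at h'
        exact hc h'
      · have h'' := h.injective h'
        apply h4 (i - 1 - 1)
        rw [sub_add_cancel, sub_add_cancel, h'']
    · rw [add_sub_cancel_right] at hc
      exact hc rfl
  have key2 : ∀ i c, c ≠ f i → H.Adj (p i) c → H.Adj (f (i + 1)) c → False := by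
    intro i c hc hb he
    rcases (h.adj_leaf_iff hp _ _).1 he with rfl | rfl | rfl
    · exact h1 i (h.tree_adj_of_ne hb (hpl i))
    · exact h2 i (hpadj _ _ hb)
    · rw [add_sub_cancel_right] at hc
      exact hc rfl
  have key3 : ∀ i c, c ≠ f i → H.Adj (p i) c → H.Adj (f (i - 1)) c → False := by
    intro i c hc hb he
    rcases (h.adj_leaf_iff hp _ _).1 he with rfl | rfl | rfl
    · exact h1' i (h.tree_adj_of_ne hb (hpl i))
    · rw [sub_add_cancel] at hc
      exact hc rfl
    · have h3 := h2 (i - 1 - 1)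
      rw [sub_add_cancel, sub_add_cancel] at h3
      exact h3 (hpadj _ _ hb).symm
  have hleaf : ∀ i b c e, H.Adj (f i) b → H.Adj b c → H.Adj c e → H.Adj e (f i) → f i ≠ c →
      b ≠ e → False := by
    intro i b c e hab hbc hce hea hac hbe
    rcases (h.adj_leaf_iff hp _ _).1 hab with rfl | rfl | rfl <;>
    rcases (h.adj_leaf_iff hp _ _).1 hea.symm with rfl | rfl | rfl
    · exact hbe rfl
    · exact key2 _ _ hac.symm hbc hce.symm
    · exact key3 _ _ hac.symm hbc hce.symm
    · exact key2 _ _ hac.symm hce.symm hbc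
    · exact hbe rfl
    · exact key1 _ _ hac.symm hbc hce.symm
    · exact key3 _ _ hac.symm hce.symm hbc
    · exact key1 _ _ hac.symm hce.symm hbc
    · exact hbe rfl
  rw [SimpleGraph.cycleGraph_four_free_iff]
  intro a b c e hab hbc hce hea hac hbe
  by_cases ha : ∃ i, a = f i
  · obtain ⟨i, rfl⟩ := ha
    exact hleaf i b c e hab hbc hce hea hac hbe
  by_cases hb : ∃ i, b = f i
  · obtain ⟨i, rfl⟩ := hb
    exact hleaf i c e a hbc hce hea hab hbe hac.symm
  by_cases hc : ∃ i, c = f i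
  · obtain ⟨i, rfl⟩ := hc
    exact hleaf i e a b hce hea hab hbc hac.symm hbe.symm
  by_cases he : ∃ i, e = f i
  · obtain ⟨i, rfl⟩ := he
    exact hleaf i a b c hea hab hbc hce hbe.symm hac
  · simp only [not_exists] at ha hb hc he
    exact SimpleGraph.cycleGraph_four_free_iff.1
      (SimpleGraph.isAcyclic_iff_free_cycleGraph.1 h.isTree.isAcyclic 4 (by norm_num)) a b c e
      (h.tree_adj_of_ne hab ha) (h.tree_adj_of_ne hbc hb) (h.tree_adj_of_ne hce hc)
      (h.tree_adj_of_ne hea he) hac hbe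

end IsTreeCycleUnion

/-! ### Plane trees and planarity of their Halin graphs -/

open Classical in
/-- A labelling of darts that is consistent around the vertices comes from the faces of a
permutation of the darts. -/
theorem exists_perm_of_labels {G : SimpleGraph V} [Finite V] {α : Type*} (L : G.Dart → α)
    (hex : ∀ d : G.Dart, ∃ d' : G.Dart, d'.fst = d.fst ∧ L d' = L d.symm)
    (hinj : ∀ d d' : G.Dart, d.fst = d'.fst → L d.symm = L d'.symm → d = d') :
    ∃ σ : Equiv.Perm G.Dart, (∀ d, (σ d).fst = d.fst) ∧ (∀ d, L (σ d) = L d.symm) ∧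
      ∀ d d', d.fst = d'.fst → L d = L d' → d = d' := by
  have := Fintype.ofFinite V
  choose g hg using hex
  have hgi : Function.Injective g := by
    intro d d' h
    refine hinj d d' ?_ ?_
    · rw [← (hg d).1, ← (hg d').1, h]
    · rw [← (hg d).2, ← (hg d').2, h]
  have hgb : Function.Bijective g := Finite.injective_iff_bijective.1 hgi
  refine ⟨Equiv.ofBijective g hgb, fun d => (hg d).1, fun d => (hg d).2, fun d d' h1 h2 => ?_⟩
  obtain ⟨e, rfl⟩ := hgb.2 d
  obtain ⟨e', rfl⟩ := hgb.2 d'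
  rw [(hg e).1, (hg e').1] at h1
  rw [(hg e).2, (hg e').2] at h2
  rw [hinj e e' h1 h2]

/-- A plane rooted tree with `m + 3` leaves `leaf 0, leaf 1, …`, enumerated from left to right. The
leaves below a vertex `v` are those with index in `[lo v, hi v)`. -/
structure PlaneTree (V : Type*) (m : ℕ) where
  root : V
  par : V → V
  lo : V → ℕ
  hi : V → ℕ
  depth : V → ℕ
  leaf : Fin (m + 3) ↪ V
  depth_par : ∀ v, v ≠ root → depth (par v) < depth v
  lo_root : lo root = 0
  hi_root : hi root = m + 3
  lo_leaf : ∀ i, lo (leaf i) = i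
  hi_leaf : ∀ i, hi (leaf i) = i + 1
  leaf_ne_root : ∀ i, leaf i ≠ root
  par_ne_leaf : ∀ v i, v ≠ root → par v ≠ leaf i
  lo_lt_hi : ∀ v, lo v < hi v
  lo_par_le : ∀ v, v ≠ root → lo (par v) ≤ lo v
  hi_le_par : ∀ v, v ≠ root → hi v ≤ hi (par v)
  proper : ∀ v, v ≠ root → lo v = lo (par v) → hi v ≠ hi (par v)
  lo_inj : ∀ u v, u ≠ root → v ≠ root → par u = par v → lo u = lo v → u = v
  hi_inj : ∀ u v, u ≠ root → v ≠ root → par u = par v → hi u = hi v → u = v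
  next : ∀ v, v ≠ root → hi v ≠ hi (par v) → ∃ u, u ≠ root ∧ par u = par v ∧ lo u = hi v
  first : ∀ v, (∀ i, v ≠ leaf i) → ∃ u, u ≠ root ∧ par u = v ∧ lo u = lo v
  root_children : ∃ a b c, a ≠ root ∧ b ≠ root ∧ c ≠ root ∧ a ≠ b ∧ a ≠ c ∧ b ≠ c ∧
    par a = root ∧ par b = root ∧ par c = root

namespace PlaneTree

variable (P : PlaneTree V m)

theorem par_ne (v : V) (hv : v ≠ P.root) : P.par v ≠ v := fun h =>
  absurd (P.depth_par v hv) (by rw [h]; exact lt_irrefl _)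

/-- The underlying tree. -/
def tree : SimpleGraph V where
  Adj u v := (u ≠ P.root ∧ P.par u = v) ∨ (v ≠ P.root ∧ P.par v = u)
  symm := ⟨fun _ _ h => h.symm⟩
  loopless := ⟨fun u h => by
    rcases h with h | h <;> exact P.par_ne u h.1 h.2⟩

theorem tree_adj_par (v : V) (hv : v ≠ P.root) : P.tree.Adj v (P.par v) := Or.inl ⟨hv, rfl⟩

theorem reachable_root (v : V) : P.tree.Reachable v P.root := by
  induction hd : P.depth v using Nat.strong_induction_on generalizing v with
  | _ n ih =>
    by_cases hv : v = P.root
    · rw [hv]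
    · exact (P.tree_adj_par v hv).reachable.trans (ih _ (hd ▸ P.depth_par v hv) _ rfl)

/-- The graph is connected through the root, and its edges correspond to the non-root vertices:
decreasing depth prevents two vertices from being each other's parent. -/
theorem isTree_tree [Finite V] : P.tree.IsTree := by
  rw [SimpleGraph.isTree_iff_connected_and_card]
  have : Nonempty V := ⟨P.root⟩
  refine ⟨⟨fun u v => (P.reachable_root u).trans (P.reachable_root v).symm⟩, ?_⟩
  have hset : P.tree.edgeSet = (fun v => s(v, P.par v)) '' {P.root}ᶜ := by
    ext e
    induction e using Sym2.ind with
    | _ u v =>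
      simp only [SimpleGraph.mem_edgeSet, Set.mem_image, Set.mem_compl_iff, Set.mem_singleton_iff,
        Sym2.eq_iff]
      constructor
      · rintro (⟨h, rfl⟩ | ⟨h, rfl⟩)
        · exact ⟨u, h, Or.inl ⟨rfl, rfl⟩⟩
        · exact ⟨v, h, Or.inr ⟨rfl, rfl⟩⟩
      · rintro ⟨x, hx, ⟨rfl, rfl⟩ | ⟨rfl, rfl⟩⟩
        · exact Or.inl ⟨hx, rfl⟩
        · exact Or.inr ⟨hx, rfl⟩
  have hinj : Set.InjOn (fun v => s(v, P.par v)) {P.root}ᶜ := by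
    intro u hu v hv h
    simp only [Set.mem_compl_iff, Set.mem_singleton_iff] at hu hv
    rcases Sym2.eq_iff.1 h with ⟨h', -⟩ | ⟨h1, h2⟩
    · exact h'
    · have h3 := P.depth_par u hu
      have h4 := P.depth_par v hv
      rw [h2] at h3
      rw [← h1] at h4
      omega
  rw [Nat.card_coe_set_eq, hset, hinj.ncard_image, Set.ncard_compl,
    Set.ncard_singleton]
  have : 0 < Nat.card V := Nat.card_pos
  omega

/-- The Halin graph of a plane tree. -/
def halin : SimpleGraph V := P.tree ⊔ (SimpleGraph.cycleGraph (m + 3)).map P.leaf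

theorem neighborSet_leaf (i : Fin (m + 3)) :
    P.tree.neighborSet (P.leaf i) = {P.par (P.leaf i)} := by
  ext v
  simp only [SimpleGraph.mem_neighborSet, Set.mem_singleton_iff]
  constructor
  · rintro (⟨-, h⟩ | ⟨hv, h⟩)
    · exact h.symm
    · exact absurd h (P.par_ne_leaf v i hv)
  · rintro rfl
    exact P.tree_adj_par _ (P.leaf_ne_root i)

/-- Away from the root there are the parent, a first child, and a sibling to its right, because by
`proper` the first child cannot own the whole interval. -/
theorem three_le_ncard_neighborSet [Finite V] (v : V) (hv : ∀ i, v ≠ P.leaf i) :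
    3 ≤ (P.tree.neighborSet v).ncard := by
  obtain ⟨a, b, c, hab, hac, hbc, ha, hb, hc⟩ : ∃ a b c, a ≠ b ∧ a ≠ c ∧ b ≠ c ∧
      P.tree.Adj v a ∧ P.tree.Adj v b ∧ P.tree.Adj v c := by
    by_cases hr : v = P.root
    · obtain ⟨a, b, c, ha, hb, hc, hab, hac, hbc, ha', hb', hc'⟩ := P.root_children
      rw [hr]
      exact ⟨a, b, c, hab, hac, hbc, Or.inr ⟨ha, ha'⟩, Or.inr ⟨hb, hb'⟩, Or.inr ⟨hc, hc'⟩⟩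
    · obtain ⟨b, hb, hb', hlo⟩ := P.first v hv
      obtain ⟨c, hc, hc', hlo'⟩ := P.next b hb (P.proper b hb (by rw [hb', hlo]))
      refine ⟨P.par v, b, c, ?_, ?_, ?_, P.tree_adj_par v hr, Or.inr ⟨hb, hb'⟩,
        Or.inr ⟨hc, hc'.trans hb'⟩⟩
      · rintro rfl
        have h1 := P.depth_par v hr
        have h2 := P.depth_par _ hb
        rw [hb'] at h2
        omega
      · rintro rfl
        have h1 := P.depth_par v hr
        have h2 := P.depth_par _ hc
        rw [hc', hb'] at h2
        omega
      · rintro rfl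
        have := P.lo_lt_hi b
        omega
  have hsub : ({a, b, c} : Set V) ⊆ P.tree.neighborSet v := by
    rintro x (rfl | rfl | rfl)
    · exact ha
    · exact hb
    · exact hc
  have hcard : ({a, b, c} : Set V).ncard = 3 := Set.ncard_eq_three.2 ⟨a, b, c, hab, hac, hbc, rfl⟩
  rw [← hcard]
  exact Set.ncard_le_ncard hsub

theorem range_leaf [Finite V] : Set.range P.leaf = leafSet P.tree := by
  ext v
  constructor
  · rintro ⟨i, rfl⟩
    rw [leafSet, Set.mem_ofPred_eq, neighborSet_leaf, Set.ncard_singleton]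
  · intro hv
    by_contra h
    have := P.three_le_ncard_neighborSet v fun i hi => h ⟨i, hi.symm⟩
    rw [leafSet, Set.mem_ofPred_eq] at hv
    omega

theorem isTreeCycleUnion [Finite V] : IsTreeCycleUnion P.halin P.tree P.leaf :=
  isTreeCycleUnion_of_leafSet P.isTree_tree P.leaf P.range_leaf

end PlaneTree

end

section

variable {V : Type*} {m : ℕ}

namespace PlaneTree

variable (P : PlaneTree V m)

/-- The face to the right of the last leaf is the one to the left of the first leaf. -/
def wrap (m x : ℕ) : ℕ := if x = m + 3 then 0 else x

theorem val_add_one (i : Fin (m + 3)) : (i + 1).val = wrap m (i + 1) := by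
  rw [wrap, Fin.val_add_one]
  simp only [Fin.ext_iff, Fin.val_last]
  split_ifs <;> omega

theorem hi_le (v : V) : P.hi v ≤ m + 3 := by
  induction hd : P.depth v using Nat.strong_induction_on generalizing v with
  | _ n ih =>
    by_cases hv : v = P.root
    · rw [hv, P.hi_root]
    · exact (P.hi_le_par v hv).trans (ih _ (hd ▸ P.depth_par v hv) _ rfl)

theorem eq_root_of_full (v : V) (hlo : P.lo v = 0) (hhi : P.hi v = m + 3) : v = P.root := by
  by_contra hv
  have h1 := P.lo_par_le v hv
  have h2 := P.hi_le_par v hv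
  have h3 := P.hi_le (P.par v)
  exact P.proper v hv (by omega) (by omega)

open Classical in
/-- The face to the left of a dart of the Halin graph; `none` is the outer face. -/
noncomputable def label (u v : V) : Option ℕ :=
  if u ≠ P.root ∧ P.par u = v then some (wrap m (P.hi u))
  else if v ≠ P.root ∧ P.par v = u then some (P.lo v)
  else if ∃ i, u = P.leaf i ∧ v = P.leaf (i + 1) then none
  else some (P.lo u)

theorem label_up (v : V) (hv : v ≠ P.root) :
    P.label v (P.par v) = some (wrap m (P.hi v)) := if_pos ⟨hv, rfl⟩

theorem label_down (v : V) (hv : v ≠ P.root) : P.label (P.par v) v = some (P.lo v) := by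
  rw [label, if_neg, if_pos ⟨hv, rfl⟩]
  rintro ⟨h1, h2⟩
  have h3 := P.depth_par v hv
  have h4 := P.depth_par _ h1
  rw [h2] at h4
  omega

theorem not_par_leaf (i : Fin (m + 3)) (u : V) : ¬ (u ≠ P.root ∧ P.par u = P.leaf i) :=
  fun h => P.par_ne_leaf u i h.1 h.2

theorem label_next (i : Fin (m + 3)) : P.label (P.leaf i) (P.leaf (i + 1)) = none := by
  rw [label, if_neg (P.not_par_leaf _ _), if_neg (P.not_par_leaf _ _), if_pos ⟨i, rfl, rfl⟩]

theorem label_prev (i : Fin (m + 3)) :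
    P.label (P.leaf (i + 1)) (P.leaf i) = some (i + 1).val := by
  rw [label, if_neg (P.not_par_leaf _ _), if_neg (P.not_par_leaf _ _), if_neg, P.lo_leaf]
  rintro ⟨j, h1, h2⟩
  have h1 := P.leaf.injective h1
  have h2 := P.leaf.injective h2
  rw [← h1] at h2
  exact Fin.add_one_add_one_ne i h2.symm

theorem adj_cases [Finite V] {u v : V} (h : P.halin.Adj u v) :
    (u ≠ P.root ∧ v = P.par u) ∨ (v ≠ P.root ∧ u = P.par v) ∨
    (∃ i, u = P.leaf i ∧ v = P.leaf (i + 1)) ∨ ∃ i, u = P.leaf (i + 1) ∧ v = P.leaf i := by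
  rcases (P.isTreeCycleUnion.adj_iff u v).1 h with (⟨h, h'⟩ | ⟨h, h'⟩) | ⟨i, h | h⟩
  · exact Or.inl ⟨h, h'.symm⟩
  · exact Or.inr (Or.inl ⟨h, h'.symm⟩)
  · exact Or.inr (Or.inr (Or.inl ⟨i, h⟩))
  · exact Or.inr (Or.inr (Or.inr ⟨i, h⟩))

theorem halin_adj_par [Finite V] (v : V) (hv : v ≠ P.root) : P.halin.Adj v (P.par v) :=
  P.isTreeCycleUnion.le (P.tree_adj_par v hv)

theorem halin_adj_next [Finite V] (i : Fin (m + 3)) :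
    P.halin.Adj (P.leaf i) (P.leaf (i + 1)) :=
  (P.isTreeCycleUnion.adj_leaves_iff _ _).2 (Or.inl rfl)

theorem wrap_hi_inj {u v : V} (h : wrap m (P.hi u) = wrap m (P.hi v)) : P.hi u = P.hi v := by
  have h1 := P.lo_lt_hi u
  have h2 := P.lo_lt_hi v
  unfold wrap at h
  split_ifs at h <;> omega

/-- Before wrapping, `lo u < hi v`. Wrapping could produce equality only if `u` owned all leaves,
that is, at the root, where the two sides do bound the same face. -/
theorem lo_ne_wrap_hi {u v : V} (hu : u ≠ P.root) (hv : v ≠ P.root) (h : P.par v = u) :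
    P.lo u ≠ wrap m (P.hi v) := by
  intro h'
  have h1 := P.lo_par_le v hv
  have h2 := P.hi_le_par v hv
  have h3 := P.lo_lt_hi v
  have h4 := P.hi_le u
  rw [h] at h1 h2
  unfold wrap at h'
  split_ifs at h' with h5
  · exact hu (P.eq_root_of_full u h' (by omega))
  · omega

/-- The witness is the next neighbour around `u`. After the parent comes the first child; after a
child its right sibling, or the parent if there is none (at the root, the first child again). At a
leaf the order is parent, previous leaf, next leaf. -/
theorem exists_label [Finite V] {u v : V} (h : P.halin.Adj u v) :
    ∃ w, P.halin.Adj u w ∧ P.label u w = P.label v u := by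
  rcases P.adj_cases h with ⟨hu, rfl⟩ | ⟨hv, rfl⟩ | ⟨i, rfl, rfl⟩ | ⟨i, rfl, rfl⟩
  · rw [P.label_down u hu]
    by_cases hl : ∃ i, u = P.leaf i
    · obtain ⟨i, rfl⟩ := hl
      have h1 := P.label_prev (i - 1)
      rw [sub_add_cancel] at h1
      have h2 := P.halin_adj_next (i - 1)
      rw [sub_add_cancel] at h2
      exact ⟨_, h2.symm, by rw [h1, P.lo_leaf]⟩
    · obtain ⟨c, hc, rfl, hlo⟩ := P.first u fun i hi => hl ⟨i, hi⟩
      exact ⟨c, (P.halin_adj_par c hc).symm, by rw [P.label_down c hc, hlo]⟩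
  · rw [P.label_up v hv]
    by_cases hlast : P.hi v = P.hi (P.par v)
    · by_cases hr : P.par v = P.root
      · obtain ⟨c, hc, hc', hlo⟩ := P.first P.root fun i hi => P.leaf_ne_root i hi.symm
        refine ⟨c, ?_, ?_⟩
        · rw [hr, ← hc']
          exact (P.halin_adj_par c hc).symm
        · have := P.label_down c hc
          rw [hc'] at this
          rw [hr, this, hlo, P.lo_root, hlast, hr, P.hi_root, wrap, if_pos rfl]
      · exact ⟨_, P.halin_adj_par _ hr, by rw [P.label_up _ hr, hlast]⟩
    · obtain ⟨w, hw, hwv, hlo⟩ := P.next v hv hlast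
      refine ⟨w, ?_, ?_⟩
      · rw [← hwv]
        exact (P.halin_adj_par w hw).symm
      · have := P.label_down w hw
        have h1 := P.lo_lt_hi w
        have h2 := P.hi_le w
        rw [hwv] at this
        rw [this, hlo, wrap, if_neg (by omega)]
  · refine ⟨_, P.halin_adj_par _ (P.leaf_ne_root i), ?_⟩
    rw [P.label_up _ (P.leaf_ne_root i), P.label_prev, P.hi_leaf, val_add_one]
  · exact ⟨_, P.halin_adj_next _, by rw [P.label_next, P.label_next]⟩

/-- Different sectors at a vertex lie in different faces, so labels alone determine the rotation. -/
theorem label_symm_injective [Finite V] {u v w : V} (hv : P.halin.Adj u v) (hw : P.halin.Adj u w)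
    (h : P.label v u = P.label w u) : v = w := by
  rcases P.adj_cases hv with ⟨hu, rfl⟩ | ⟨hv', rfl⟩ | ⟨i, rfl, rfl⟩ | ⟨i, rfl, rfl⟩
  · rw [P.label_down _ hu] at h
    rcases P.adj_cases hw with ⟨-, rfl⟩ | ⟨hw', rfl⟩ | ⟨j, rfl, rfl⟩ | ⟨j, rfl, rfl⟩
    · rfl
    · rw [P.label_up _ hw', Option.some.injEq] at h
      exact absurd h (P.lo_ne_wrap_hi hu hw' rfl)
    · rw [P.label_prev, Option.some.injEq, P.lo_leaf] at h
      exact absurd (Fin.ext h).symm (Fin.add_one_ne j)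
    · rw [P.label_next] at h
      exact absurd h (by simp)
  · rw [P.label_up _ hv'] at h
    rcases P.adj_cases hw with ⟨hu, rfl⟩ | ⟨hw', hvw⟩ | ⟨j, hj, rfl⟩ | ⟨j, hj, rfl⟩
    · rw [P.label_down _ hu, Option.some.injEq] at h
      exact absurd h.symm (P.lo_ne_wrap_hi hu hv' rfl)
    · rw [hvw, P.label_up _ hw', Option.some.injEq] at h
      exact P.hi_inj _ _ hv' hw' hvw (P.wrap_hi_inj h)
    · exact absurd hj (P.par_ne_leaf _ _ hv')
    · exact absurd hj (P.par_ne_leaf _ _ hv')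
  · rw [P.label_prev] at h
    rcases P.adj_cases hw with ⟨hu, rfl⟩ | ⟨hw', hj⟩ | ⟨j, hj, rfl⟩ | ⟨j, hj, rfl⟩
    · rw [P.label_down _ hu, Option.some.injEq, P.lo_leaf] at h
      exact absurd (Fin.ext h) (Fin.add_one_ne i)
    · exact absurd hj.symm (P.par_ne_leaf _ _ hw')
    · rw [P.leaf.injective hj]
    · rw [hj, P.label_next] at h
      exact absurd h (by simp)
  · rw [P.label_next] at h
    rcases P.adj_cases hw with ⟨hu, rfl⟩ | ⟨hw', hj⟩ | ⟨j, hj, rfl⟩ | ⟨j, hj, rfl⟩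
    · rw [P.label_down _ hu] at h
      exact absurd h (by simp)
    · exact absurd hj.symm (P.par_ne_leaf _ _ hw')
    · rw [hj, P.label_prev] at h
      exact absurd h (by simp)
    · rw [add_right_cancel (P.leaf.injective hj)]

/-- The plane embedding of the Halin graph. -/
theorem exists_rotation [Finite V] : ∃ σ : Equiv.Perm P.halin.Dart, IsRotationSystem σ ∧
    ∀ d, P.label (σ d).fst (σ d).snd = P.label d.snd d.fst := by
  obtain ⟨σ, hfst, hlab, hinj⟩ := exists_perm_of_labels
    (fun d : P.halin.Dart => P.label d.fst d.snd)
    (fun d => by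
      obtain ⟨w, hw, hw'⟩ := P.exists_label d.adj
      exact ⟨⟨(d.fst, w), hw⟩, rfl, hw'⟩)
    (fun d d' h1 h2 => by
      refine SimpleGraph.Dart.ext _ _ (Prod.ext h1 (P.label_symm_injective d.adj ?_ ?_))
      · rw [h1]
        exact d'.adj
      · have h2' : P.label d.snd d.fst = P.label d'.snd d'.fst := h2
        rw [h2', h1])
  refine ⟨σ, ⟨hfst, ?_⟩, hlab⟩
  have hstep : ∀ {u v w : V} (hv : P.halin.Adj u v) (hw : P.halin.Adj u w),
      P.label u w = P.label v u → σ.SameCycle ⟨(u, v), hv⟩ ⟨(u, w), hw⟩ := by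
    intro u v w hv hw h
    have : σ ⟨(u, v), hv⟩ = ⟨(u, w), hw⟩ := hinj _ _ (hfst _) ((hlab _).trans h.symm)
    rw [← this]
    exact ⟨1, by simp⟩
  -- The base dart goes to the parent, and at the root to the last child; rotation through right
  -- siblings, `hlast`, leads there from any child.
  suffices hbase : ∀ u, ∃ b : P.halin.Dart, ∀ v (hv : P.halin.Adj u v),
      σ.SameCycle ⟨(u, v), hv⟩ b by
    rintro ⟨⟨u, v⟩, hd⟩ ⟨⟨u', v'⟩, hd'⟩ (rfl : u = u')
    obtain ⟨b, hb⟩ := hbase u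
    exact (hb v hd).trans (hb v' hd').symm
  have hlast : ∀ n v (hv : v ≠ P.root), m + 3 - P.hi v = n → ∃ w, ∃ hw : w ≠ P.root,
      ∃ hwv : P.par w = P.par v, P.hi w = P.hi (P.par v) ∧
      σ.SameCycle ⟨(P.par v, v), (P.halin_adj_par v hv).symm⟩
        ⟨(P.par v, w), hwv ▸ (P.halin_adj_par w hw).symm⟩ := by
    intro n
    induction n using Nat.strong_induction_on with
    | _ n ih =>
      intro v hv hn
      by_cases hl : P.hi v = P.hi (P.par v)
      · exact ⟨v, hv, rfl, hl, .refl _ _⟩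
      · obtain ⟨u, hu, huv, hlo⟩ := P.next v hv hl
        have h1 := P.lo_lt_hi u
        have h2 := P.hi_le u
        obtain ⟨w, hw, hwu, hhi, hsc⟩ := ih _ (by omega) u hu rfl
        refine ⟨w, hw, hwu.trans huv, by rw [← huv]; exact hhi, ?_⟩
        have hlabel : P.label (P.par v) u = P.label v (P.par v) := by
          have := P.label_down u hu
          rw [huv] at this
          rw [this, P.label_up v hv, hlo, wrap, if_neg (by omega)]
        have hadj : P.halin.Adj (P.par v) u := huv ▸ (P.halin_adj_par u hu).symm
        refine (hstep (P.halin_adj_par v hv).symm hadj hlabel).trans ?_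
        simp only [huv] at hsc
        exact hsc
  intro u
  by_cases hl : ∃ i, u = P.leaf i
  · obtain ⟨i, rfl⟩ := hl
    have hup := P.halin_adj_par _ (P.leaf_ne_root i)
    have hnext : σ.SameCycle ⟨(P.leaf i, P.leaf (i + 1)), P.halin_adj_next i⟩ ⟨(_, _), hup⟩ := by
      apply hstep
      rw [P.label_up _ (P.leaf_ne_root i), P.label_prev, P.hi_leaf, val_add_one]
    refine ⟨⟨(_, _), hup⟩, fun v hv => ?_⟩
    rcases P.adj_cases hv with ⟨-, rfl⟩ | ⟨hw, hj⟩ | ⟨j, hj, rfl⟩ | ⟨j, hj, rfl⟩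
    · exact .refl _ _
    · exact absurd hj.symm (P.par_ne_leaf _ _ hw)
    · obtain rfl := P.leaf.injective hj
      exact hnext
    · obtain rfl := P.leaf.injective hj
      refine (hstep hv (P.halin_adj_next _) ?_).trans hnext
      rw [P.label_next, P.label_next]
  · by_cases hr : u = P.root
    · subst hr
      obtain ⟨c, hc, hc', -⟩ := P.first P.root fun i hi => P.leaf_ne_root i hi.symm
      obtain ⟨w, hw, hwc, hhi, -⟩ := hlast _ c hc rfl
      rw [hc'] at hwc hhi
      refine ⟨⟨(P.root, w), by rw [← hwc]; exact (P.halin_adj_par w hw).symm⟩, fun v hv => ?_⟩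
      rcases P.adj_cases hv with ⟨h, -⟩ | ⟨hv', hvr⟩ | ⟨j, hj, -⟩ | ⟨j, hj, -⟩
      · exact absurd rfl h
      · obtain ⟨w', hw', hwv, hhi', hsc⟩ := hlast _ v hv' rfl
        rw [← hvr] at hwv hhi'
        obtain rfl := P.hi_inj _ _ hw hw' (hwc.trans hwv.symm) (hhi.trans hhi'.symm)
        simp only [← hvr] at hsc
        exact hsc
      · exact absurd hj.symm (P.leaf_ne_root j)
      · exact absurd hj.symm (P.leaf_ne_root _)
    · refine ⟨⟨(u, P.par u), P.halin_adj_par u hr⟩, fun v hv => ?_⟩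
      rcases P.adj_cases hv with ⟨-, rfl⟩ | ⟨hv', hvu⟩ | ⟨j, hj, -⟩ | ⟨j, hj, -⟩
      · exact .refl _ _
      · obtain ⟨w, hw, hwv, hhi, hsc⟩ := hlast _ v hv' rfl
        simp only [← hvu] at hwv hhi hsc
        refine hsc.trans (hstep _ _ ?_)
        have := P.label_up w hw
        rw [hwv] at this
        rw [this, P.label_up u hr, hhi]
      · exact absurd ⟨j, hj⟩ hl
      · exact absurd ⟨_, hj⟩ hl

/-- Labels are constant on faces, and the darts of the cycle already carry `none` and all of `0, …,
m + 2`. So there are at least `m + 4` faces, and `card_face_le` forbids more. -/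
theorem isPlanarGraph_halin [Finite V] : IsPlanarGraph P.halin := by
  classical
  have := Fintype.ofFinite V
  have hU := P.isTreeCycleUnion
  obtain ⟨σ, hσ, hlab⟩ := P.exists_rotation
  refine hU.isPlanarGraph_iff.2 ⟨σ, hσ, le_antisymm (hU.card_face_le hσ) ?_⟩
  have hinv : ∀ d, P.label (facePerm σ d).fst (facePerm σ d).snd = P.label d.fst d.snd :=
    fun d => hlab d.symm
  have hresp : ∀ a b, (facePerm σ).SameCycle a b → P.label a.fst a.snd = P.label b.fst b.snd := by
    rintro a _ ⟨i, rfl⟩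
    induction i with
    | zero => rfl
    | succ i ih => rw [ih, add_comm, zpow_add, zpow_one, Equiv.Perm.mul_apply, hinv]
    | pred i ih =>
      rw [ih, ← hinv ((facePerm σ ^ (-(i : ℤ) - 1)) a), ← Equiv.Perm.mul_apply, ← zpow_one_add]
      congr 5 <;> ring
  let t : IsTreeCycleUnion.Face σ → Option ℕ := Quotient.lift _ hresp
  let g : Option (Fin (m + 3)) → IsTreeCycleUnion.Face σ := fun o =>
    o.elim (Quotient.mk _ (hU.cycDart 0)) fun i => Quotient.mk _ (hU.cycDart (i - 1)).symm
  have htg : ∀ o, t (g o) = o.map Fin.val := by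
    rintro (_ | i)
    · exact P.label_next 0
    · refine (P.label_prev (i - 1)).trans ?_
      rw [sub_add_cancel]
      rfl
  have hg : Function.Injective g := by
    intro a b hab
    have h := congrArg t hab
    rw [htg, htg] at h
    exact Option.map_injective Fin.val_injective h
  have := Nat.card_le_card_of_injective g hg
  simpa using this

theorem isHalinGraph_halin [Finite V] : IsHalinGraph P.halin := by
  refine ⟨P.tree, _, P.isTree_tree, ?_, ⟨m + 3, by omega, P.leaf, P.range_leaf, rfl⟩, ?_, rfl,
    P.isPlanarGraph_halin⟩
  · intro v hv
    rw [← P.range_leaf] at hv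
    exact P.three_le_ncard_neighborSet v fun i hi => hv ⟨i, hi.symm⟩
  · rw [SimpleGraph.disjoint_left]
    intro u v huv
    rw [map_cycleGraph_adj]
    exact P.isTreeCycleUnion.disjoint u v huv

/-- A criterion for the Halin graph of a plane tree to have no four-cycles. -/
theorem halin_free [Finite V] (hm : 2 ≤ m)
    (h1 : ∀ i, P.par (P.leaf i) ≠ P.root → P.par (P.par (P.leaf i)) ≠ P.par (P.leaf (i + 1)))
    (h1' : ∀ i, P.par (P.leaf (i + 1)) ≠ P.root →
      P.par (P.par (P.leaf (i + 1))) ≠ P.par (P.leaf i))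
    (h2 : ∀ i, P.par (P.leaf i) ≠ P.par (P.leaf (i + 1 + 1))) :
    (SimpleGraph.cycleGraph 4).Free P.halin := by
  refine P.isTreeCycleUnion.cycleGraph_four_free hm (p := fun i => P.par (P.leaf i))
    (fun i => P.tree_adj_par _ (P.leaf_ne_root i)) (fun i => ?_) h2
  rintro (⟨h, h'⟩ | ⟨h, h'⟩)
  · exact h1 i h h'
  · exact h1' i h h'

end PlaneTree

end

/-! ### Plane trees encoded by arithmetic functions -/

/-- The functions `par`, `lo`, `hi` on natural numbers describe a plane tree with vertices
`0, …, n - 1`, leaves `0, …, m + 2` and root `n - 1`, in which vertices precede their parents and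
whose Halin graph has no four-cycles. -/
structure IsPlaneTreeCode (n m : ℕ) (par lo hi : ℕ → ℕ) : Prop where
  two_le : 2 ≤ m
  lt : m + 3 < n
  par_spec : ∀ v, v + 1 < n → v < par v ∧ par v < n ∧ m + 3 ≤ par v
  root_spec : lo (n - 1) = 0 ∧ hi (n - 1) = m + 3
  leaf_spec : ∀ i, i < m + 3 → lo i = i ∧ hi i = i + 1
  lo_lt_hi : ∀ v, v < n → lo v < hi v
  par_interval : ∀ v, v + 1 < n → lo (par v) ≤ lo v ∧ hi v ≤ hi (par v) ∧
    (lo v = lo (par v) → hi v ≠ hi (par v))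
  sibling : ∀ u v, u + 1 < n → v + 1 < n → par u = par v →
    (lo u = lo v → u = v) ∧ (hi u = hi v → u = v)
  next : ∀ v, v + 1 < n → hi v ≠ hi (par v) → ∃ u, u + 1 < n ∧ par u = par v ∧ lo u = hi v
  first : ∀ v, m + 3 ≤ v → v < n → ∃ u, u + 1 < n ∧ par u = v ∧ lo u = lo v
  root_children : ∃ a b c, a + 1 < n ∧ b + 1 < n ∧ c + 1 < n ∧ a ≠ b ∧ a ≠ c ∧ b ≠ c ∧
    par a = n - 1 ∧ par b = n - 1 ∧ par c = n - 1
  not_adj : ∀ i j, i < m + 3 → j < m + 3 → (j = i + 1 ∨ i = j + (m + 2)) →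
    (par i + 1 < n → par (par i) ≠ par j) ∧ (par j + 1 < n → par (par j) ≠ par i)
  par_ne : ∀ i j, i < m + 3 → j < m + 3 → (j = i + 2 ∨ i = j + (m + 1)) → par i ≠ par j

namespace IsPlaneTreeCode

variable {n m : ℕ} {par lo hi : ℕ → ℕ}

/-- The plane tree with a given code. -/
def toPlaneTree (h : IsPlaneTreeCode n m par lo hi) : PlaneTree (Fin n) m where
  root := ⟨n - 1, by have := h.lt; omega⟩
  -- The value at the root is a dummy. Parents have larger numbers, so `n - v` serves as depth.
  par v := if hv : v.val + 1 < n then ⟨par v, (h.par_spec v hv).2.1⟩ else v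
  lo v := lo v
  hi v := hi v
  depth v := n - v
  leaf := ⟨fun i => ⟨i, i.isLt.trans h.lt⟩, fun i j hij => Fin.ext (Fin.mk.inj hij)⟩
  depth_par v hv := by
    have hv' : v.val + 1 < n := by rw [Ne, Fin.ext_iff] at hv; have := v.isLt; simp at hv; omega
    have := h.par_spec v hv'
    simp only [dif_pos hv']
    omega
  lo_root := h.root_spec.1
  hi_root := h.root_spec.2
  lo_leaf i := (h.leaf_spec i i.isLt).1
  hi_leaf i := (h.leaf_spec i i.isLt).2
  leaf_ne_root i hi := by
    have h1 : i.val = n - 1 := congrArg Fin.val hi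
    have h2 := h.lt
    have h3 := i.isLt
    omega
  par_ne_leaf v i hv hvi := by
    have hv' : v.val + 1 < n := by rw [Ne, Fin.ext_iff] at hv; have := v.isLt; simp at hv; omega
    rw [dif_pos hv'] at hvi
    have h1 : par v = i := congrArg Fin.val hvi
    have h2 := h.par_spec v hv'
    have h3 := i.isLt
    omega
  lo_lt_hi v := h.lo_lt_hi v v.isLt
  lo_par_le v hv := by
    have hv' : v.val + 1 < n := by rw [Ne, Fin.ext_iff] at hv; have := v.isLt; simp at hv; omega
    simp only [dif_pos hv']
    exact (h.par_interval v hv').1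
  hi_le_par v hv := by
    have hv' : v.val + 1 < n := by rw [Ne, Fin.ext_iff] at hv; have := v.isLt; simp at hv; omega
    simp only [dif_pos hv']
    exact (h.par_interval v hv').2.1
  proper v hv := by
    have hv' : v.val + 1 < n := by rw [Ne, Fin.ext_iff] at hv; have := v.isLt; simp at hv; omega
    simp only [dif_pos hv']
    exact (h.par_interval v hv').2.2
  lo_inj u v hu hv hp hl := by
    have hu' : u.val + 1 < n := by rw [Ne, Fin.ext_iff] at hu; have := u.isLt; simp at hu; omega
    have hv' : v.val + 1 < n := by rw [Ne, Fin.ext_iff] at hv; have := v.isLt; simp at hv; omega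
    simp only [dif_pos hu', dif_pos hv', Fin.mk.injEq] at hp
    exact Fin.ext ((h.sibling u v hu' hv' hp).1 hl)
  hi_inj u v hu hv hp hl := by
    have hu' : u.val + 1 < n := by rw [Ne, Fin.ext_iff] at hu; have := u.isLt; simp at hu; omega
    have hv' : v.val + 1 < n := by rw [Ne, Fin.ext_iff] at hv; have := v.isLt; simp at hv; omega
    simp only [dif_pos hu', dif_pos hv', Fin.mk.injEq] at hp
    exact Fin.ext ((h.sibling u v hu' hv' hp).2 hl)
  next v hv hne := by
    have hv' : v.val + 1 < n := by rw [Ne, Fin.ext_iff] at hv; have := v.isLt; simp at hv; omega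
    simp only [dif_pos hv'] at hne ⊢
    obtain ⟨u, hu, hp, hl⟩ := h.next v hv' hne
    refine ⟨⟨u, by omega⟩, ?_, ?_, hl⟩
    · simp only [Ne, Fin.mk.injEq]
      omega
    · simp only [dif_pos hu, hp]
  first v hv := by
    have hv' : m + 3 ≤ v.val := by
      by_contra hlt
      exact hv ⟨v, by omega⟩ rfl
    obtain ⟨u, hu, hp, hl⟩ := h.first v hv' v.isLt
    refine ⟨⟨u, by omega⟩, ?_, ?_, hl⟩
    · simp only [Ne, Fin.mk.injEq]
      omega
    · simp only [dif_pos hu, hp]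
  root_children := by
    obtain ⟨a, b, c, ha, hb, hc, hab, hac, hbc, ha', hb', hc'⟩ := h.root_children
    refine ⟨⟨a, by omega⟩, ⟨b, by omega⟩, ⟨c, by omega⟩, ?_, ?_, ?_, ?_, ?_, ?_, ?_, ?_, ?_⟩
    · simp only [Ne, Fin.mk.injEq]
      omega
    · simp only [Ne, Fin.mk.injEq]
      omega
    · simp only [Ne, Fin.mk.injEq]
      omega
    · simpa using hab
    · simpa using hac
    · simpa using hbc
    · simp only [dif_pos ha, ha']
    · simp only [dif_pos hb, hb']
    · simp only [dif_pos hc, hc']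

theorem par_val (h : IsPlaneTreeCode n m par lo hi) {v : Fin n} (hv : v.val + 1 < n) :
    (h.toPlaneTree.par v).val = par v := by
  simp [toPlaneTree, dif_pos hv]

theorem par_leaf (h : IsPlaneTreeCode n m par lo hi) (i : Fin (m + 3)) :
    (h.toPlaneTree.par (h.toPlaneTree.leaf i)).val = par i := by
  have h1 : i.val + 1 < n := by have := h.lt; omega
  exact h.par_val (v := h.toPlaneTree.leaf i) h1

theorem lt_of_ne_root (h : IsPlaneTreeCode n m par lo hi) {v : Fin n}
    (hv : v ≠ h.toPlaneTree.root) : v.val + 1 < n := by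
  have h1 : v.val ≠ n - 1 := fun h' => hv (Fin.ext h')
  have := v.isLt
  omega

theorem exists_halin (h : IsPlaneTreeCode n m par lo hi) :
    ∃ H : SimpleGraph (Fin n), IsHalinGraph H ∧ (SimpleGraph.cycleGraph 4).Free H ∧
      H.edgeSet.ncard + 1 = n + (m + 3) := by
  -- The second alternative is the step from the last leaf back to leaf 0.
  have hsucc : ∀ i : Fin (m + 3), (i + 1).val = i.val + 1 ∨ i.val = (i + 1).val + (m + 2) := by
    intro i
    have h1 := PlaneTree.val_add_one i
    rw [PlaneTree.wrap] at h1
    split_ifs at h1 <;> omega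
  refine ⟨h.toPlaneTree.halin, h.toPlaneTree.isHalinGraph_halin,
    h.toPlaneTree.halin_free h.two_le ?_ ?_ ?_, ?_⟩
  · intro i hi heq
    have h1 := h.lt_of_ne_root hi
    have h2 := congrArg Fin.val heq
    rw [h.par_val h1, h.par_leaf, h.par_leaf] at h2
    rw [h.par_leaf] at h1
    exact (h.not_adj i (i + 1 : Fin _) i.isLt (Fin.isLt _) (hsucc i)).1 h1 h2
  · intro i hi heq
    have h1 := h.lt_of_ne_root hi
    have h2 := congrArg Fin.val heq
    rw [h.par_val h1, h.par_leaf, h.par_leaf] at h2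
    rw [h.par_leaf] at h1
    exact (h.not_adj i (i + 1 : Fin _) i.isLt (Fin.isLt _) (hsucc i)).2 h1 h2
  · intro i heq
    have h2 := congrArg Fin.val heq
    rw [h.par_leaf, h.par_leaf] at h2
    refine h.par_ne i (i + 1 + 1 : Fin _) i.isLt (Fin.isLt _) ?_ h2
    have h3 := hsucc i
    have h4 := hsucc (i + 1)
    have h5 := (i + 1 + 1).isLt
    generalize (i + 1 + 1).val = c at *
    generalize (i + 1).val = b at *
    omega
  · have := h.toPlaneTree.isTreeCycleUnion.ncard_edgeSet
    rwa [Nat.card_eq_fintype_card, Fintype.card_fin] at this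

end IsPlaneTreeCode

/-! ### The extremal trees -/

/-- The tree whose root has `r` children, each with two leaves. -/
theorem isPlaneTreeCode_star {n m r : ℕ} (hr : 3 ≤ r) (hm : m + 3 = 2 * r) (hn : n = 3 * r + 1) :
    IsPlaneTreeCode n m (fun v => if v < 2 * r then 2 * r + v / 2 else 3 * r)
      (fun v => if v < 2 * r then v else if v < 3 * r then 2 * (v - 2 * r) else 0)
      (fun v => if v < 2 * r then v + 1 else if v < 3 * r then 2 * (v - 2 * r) + 2 else 2 * r) where
  two_le := by omega
  lt := by omega
  par_spec v hv := by grind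
  root_spec := by grind
  leaf_spec i hi := by grind
  lo_lt_hi v hv := by grind
  par_interval v hv := by grind
  sibling u v hu hv := by grind
  next v hv hne := by
    -- Leaves come first, then the hubs, then the root `3 * r`, so siblings have consecutive
    -- numbers.
    refine ⟨v + 1, ?_⟩
    grind
  first v hv hv' := by
    refine ⟨if v < 3 * r then 2 * (v - 2 * r) else 2 * r, ?_⟩
    grind
  root_children := by
    refine ⟨2 * r, 2 * r + 1, 2 * r + 2, ?_⟩
    grind
  not_adj i j hi hj hij := by grind
  par_ne i j hi hj hij := by grind

/-- The vertices of the tree whose root has `r` children with two leaves each and one further child,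
which has one leaf to the left and `e` leaves to the right of a child with four grandchildren: a
vertex with its parent and the interval of the leaves below it. -/
def IsTwoHubsVertex (k r v p l h : ℕ) : Prop :=
  (v < 2 * r ∧ p = k + v / 2 ∧ l = v ∧ h = v + 1) ∨
  (v = 2 * r ∧ p = k + r + 3 ∧ l = v ∧ h = v + 1) ∨
  (2 * r < v ∧ v < 2 * r + 5 ∧ p = k + (v - 1) / 2 ∧ l = v ∧ h = v + 1) ∨
  (2 * r + 5 ≤ v ∧ v < k ∧ p = k + r + 3 ∧ l = v ∧ h = v + 1) ∨
  (k ≤ v ∧ v < k + r ∧ p = k + r + 4 ∧ l = 2 * (v - k) ∧ h = 2 * (v - k) + 2) ∨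
  (k + r ≤ v ∧ v < k + r + 2 ∧ p = k + r + 2 ∧ l = 2 * (v - k) + 1 ∧ h = 2 * (v - k) + 3) ∨
  (v = k + r + 2 ∧ p = k + r + 3 ∧ l = 2 * r + 1 ∧ h = 2 * r + 5) ∨
  (v = k + r + 3 ∧ p = k + r + 4 ∧ l = 2 * r ∧ h = k) ∨
  (k + r + 4 ≤ v ∧ p = k + r + 4 ∧ l = 0 ∧ h = k)

/-- The clauses cover all natural numbers, the last one being unbounded. A disjunction of linear
clauses, unlike nested conditionals, can be handed to `omega` case by case. -/
theorem exists_isTwoHubsVertex (k r : ℕ) :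
    ∃ par lo hi : ℕ → ℕ, ∀ v, IsTwoHubsVertex k r v (par v) (lo v) (hi v) := by
  have h : ∀ v, ∃ p l h, IsTwoHubsVertex k r v p l h := by
    intro v
    by_cases h1 : v < 2 * r
    · exact ⟨_, _, _, Or.inl ⟨h1, rfl, rfl, rfl⟩⟩
    by_cases h2 : v = 2 * r
    · exact ⟨_, _, _, Or.inr (Or.inl ⟨h2, rfl, rfl, rfl⟩)⟩
    by_cases h3 : v < 2 * r + 5
    · exact ⟨_, _, _, Or.inr (Or.inr (Or.inl ⟨by omega, h3, rfl, rfl, rfl⟩))⟩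
    by_cases h4 : v < k
    · exact ⟨_, _, _, Or.inr (Or.inr (Or.inr (Or.inl ⟨by omega, h4, rfl, rfl, rfl⟩)))⟩
    by_cases h5 : v < k + r
    · exact ⟨_, _, _, Or.inr (Or.inr (Or.inr (Or.inr (Or.inl ⟨by omega, h5, rfl, rfl, rfl⟩))))⟩
    by_cases h6 : v < k + r + 2
    · exact ⟨_, _, _, Or.inr (Or.inr (Or.inr (Or.inr (Or.inr (Or.inl
        ⟨by omega, h6, rfl, rfl, rfl⟩)))))⟩
    by_cases h7 : v = k + r + 2
    · exact ⟨_, _, _, Or.inr (Or.inr (Or.inr (Or.inr (Or.inr (Or.inr (Or.inl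
        ⟨h7, rfl, rfl, rfl⟩))))))⟩
    by_cases h8 : v = k + r + 3
    · exact ⟨_, _, _, Or.inr (Or.inr (Or.inr (Or.inr (Or.inr (Or.inr (Or.inr (Or.inl
        ⟨h8, rfl, rfl, rfl⟩)))))))⟩
    · exact ⟨_, _, _, Or.inr (Or.inr (Or.inr (Or.inr (Or.inr (Or.inr (Or.inr (Or.inr
        ⟨by omega, rfl, rfl, rfl⟩)))))))⟩
  choose par lo hi h using h
  exact ⟨par, lo, hi, h⟩

section TwoHubs

variable {n m r e k : ℕ} {par lo hi : ℕ → ℕ}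

theorem twoHubs_par_interval (hr : 2 ≤ r) (hk : k = 2 * r + 5 + e)
    (hn : n = k + r + 5) (hs : ∀ v, IsTwoHubsVertex k r v (par v) (lo v) (hi v))
    (v : ℕ) (hv : v + 1 < n) : lo (par v) ≤ lo v ∧ hi v ≤ hi (par v) ∧
      (lo v = lo (par v) → hi v ≠ hi (par v)) := by
  have hp := hs (par v)
  rcases hs v with h | h | h | h | h | h | h | h | h <;>
  rcases hp with h' | h' | h' | h' | h' | h' | h' | h' | h' <;> omega

theorem twoHubs_sibling (hr : 2 ≤ r) (hk : k = 2 * r + 5 + e)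
    (hn : n = k + r + 5) (hs : ∀ v, IsTwoHubsVertex k r v (par v) (lo v) (hi v))
    (u v : ℕ) (hu : u + 1 < n) (hv : v + 1 < n) (hp : par u = par v) :
    (lo u = lo v → u = v) ∧ (hi u = hi v → u = v) := by
  rcases hs u with h | h | h | h | h | h | h | h | h <;>
  rcases hs v with h' | h' | h' | h' | h' | h' | h' | h' | h' <;> omega

/-- The right sibling is `v + 1` except where siblings have different heights: leaf `2 * r` is
followed by `k + r + 2`, which is followed by leaf `2 * r + 5`, and the last two-leaf child `k + r -
1` of the root by `k + r + 3`. -/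
theorem twoHubs_next (hr : 2 ≤ r) (he : e = 1 ∨ e = 2) (hk : k = 2 * r + 5 + e)
    (hn : n = k + r + 5) (hs : ∀ v, IsTwoHubsVertex k r v (par v) (lo v) (hi v))
    (v : ℕ) (hv : v + 1 < n) (hne : hi v ≠ hi (par v)) :
    ∃ u, u + 1 < n ∧ par u = par v ∧ lo u = hi v := by
  have hp := hs (par v)
  rcases hs v with h | h | h | h | h | h | h | h | h
  · have hodd : v % 2 = 0 := by
      rcases hp with h' | h' | h' | h' | h' | h' | h' | h' | h' <;> omega
    refine ⟨v + 1, by omega, ?_⟩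
    rcases hs (v + 1) with h' | h' | h' | h' | h' | h' | h' | h' | h' <;> omega
  · refine ⟨k + r + 2, by omega, ?_⟩
    rcases hs (k + r + 2) with h' | h' | h' | h' | h' | h' | h' | h' | h' <;> omega
  · have hodd : v % 2 = 1 := by
      rcases hp with h' | h' | h' | h' | h' | h' | h' | h' | h' <;> omega
    refine ⟨v + 1, by omega, ?_⟩
    rcases hs (v + 1) with h' | h' | h' | h' | h' | h' | h' | h' | h' <;> omega
  · have hlt : v + 1 < k := by
      rcases hp with h' | h' | h' | h' | h' | h' | h' | h' | h' <;> omega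
    refine ⟨v + 1, by omega, ?_⟩
    rcases hs (v + 1) with h' | h' | h' | h' | h' | h' | h' | h' | h' <;> omega
  · by_cases hlast : v + 1 < k + r
    · refine ⟨v + 1, by omega, ?_⟩
      rcases hs (v + 1) with h' | h' | h' | h' | h' | h' | h' | h' | h' <;> omega
    · refine ⟨k + r + 3, by omega, ?_⟩
      rcases hs (k + r + 3) with h' | h' | h' | h' | h' | h' | h' | h' | h' <;> omega
  · have hlt : v = k + r := by
      rcases hp with h' | h' | h' | h' | h' | h' | h' | h' | h' <;> omega
    refine ⟨v + 1, by omega, ?_⟩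
    rcases hs (v + 1) with h' | h' | h' | h' | h' | h' | h' | h' | h' <;> omega
  · refine ⟨2 * r + 5, by omega, ?_⟩
    rcases hs (2 * r + 5) with h' | h' | h' | h' | h' | h' | h' | h' | h' <;> omega
  · rcases hp with h' | h' | h' | h' | h' | h' | h' | h' | h' <;> omega
  · omega

/-- Distinct parents of cyclically consecutive leaves are siblings or grandparent and grandchild.
The hypothesis is symmetric in `i` and `j`, so it covers both halves of `not_adj`. -/
theorem twoHubs_par_par_ne (hr : 2 ≤ r) (he : e = 1 ∨ e = 2) (hk : k = 2 * r + 5 + e)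
    (hn : n = k + r + 5) (hs : ∀ v, IsTwoHubsVertex k r v (par v) (lo v) (hi v))
    (i j : ℕ) (hi' : i < k) (hj : j < k) (hij : j = i + 1 ∨ i = j + 1 ∨ i + 1 = j + k ∨
      j + 1 = i + k) (hpi : par i + 1 < n) : par (par i) ≠ par j := by
  intro heq
  have hp := hs (par i)
  rcases hs i with h | h | h | h | h | h | h | h | h <;> try omega
  all_goals
    rcases hs j with h' | h' | h' | h' | h' | h' | h' | h' | h' <;> try omega
  all_goals
    rcases hp with h'' | h'' | h'' | h'' | h'' | h'' | h'' | h'' | h'' <;> omega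

theorem isPlaneTreeCode_twoHubs (hr : 2 ≤ r) (he : e = 1 ∨ e = 2) (hm : m + 3 = k)
    (hk : k = 2 * r + 5 + e) (hn : n = k + r + 5)
    (hs : ∀ v, IsTwoHubsVertex k r v (par v) (lo v) (hi v)) :
    IsPlaneTreeCode n m par lo hi where
  two_le := by omega
  lt := by omega
  par_spec v hv := by
    rcases hs v with h | h | h | h | h | h | h | h | h <;> omega
  root_spec := by
    rcases hs (n - 1) with h | h | h | h | h | h | h | h | h <;> omega
  leaf_spec i hi := by
    rcases hs i with h | h | h | h | h | h | h | h | h <;> omega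
  lo_lt_hi v hv := by
    rcases hs v with h | h | h | h | h | h | h | h | h <;> omega
  par_interval := twoHubs_par_interval hr hk hn hs
  sibling := twoHubs_sibling hr hk hn hs
  next := twoHubs_next hr he hk hn hs
  first v hv hv' := by
    have hv'' := hs v
    by_cases h1 : v < k + r
    · refine ⟨2 * (v - k), by omega, ?_⟩
      have h2 := hs (2 * (v - k))
      unfold IsTwoHubsVertex at h2 hv''
      omega
    by_cases h2 : v < k + r + 2
    · refine ⟨2 * (v - k) + 1, by omega, ?_⟩
      have h2 := hs (2 * (v - k) + 1)
      unfold IsTwoHubsVertex at h2 hv''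
      omega
    by_cases h3 : v = k + r + 2
    · refine ⟨k + r, by omega, ?_⟩
      have h2 := hs (k + r)
      unfold IsTwoHubsVertex at h2 hv''
      omega
    by_cases h4 : v = k + r + 3
    · refine ⟨2 * r, by omega, ?_⟩
      have h2 := hs (2 * r)
      unfold IsTwoHubsVertex at h2 hv''
      omega
    · refine ⟨k, by omega, ?_⟩
      have h2 := hs k
      unfold IsTwoHubsVertex at h2 hv''
      omega
  root_children := by
    have h1 := hs k
    have h2 := hs (k + 1)
    have h3 := hs (k + r + 3)
    unfold IsTwoHubsVertex at h1 h2 h3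
    exact ⟨k, k + 1, k + r + 3, by omega, by omega, by omega, by omega, by omega, by omega,
      by omega, by omega, by omega⟩
  not_adj i j hi hj hij :=
    ⟨twoHubs_par_par_ne hr he hk hn hs i j (by omega) (by omega) (by omega),
      twoHubs_par_par_ne hr he hk hn hs j i (by omega) (by omega) (by omega)⟩
  par_ne i j hi hj hij := by
    rcases hs i with h | h | h | h | h | h | h | h | h <;>
    rcases hs j with h' | h' | h' | h' | h' | h' | h' | h' | h' <;> omega

end TwoHubs

/-! ### Matching the two bounds -/

theorem isHalinTuranNumber_of_isPlaneTreeCode {n m N : ℕ} {par lo hi : ℕ → ℕ}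
    (h : IsPlaneTreeCode n m par lo hi) (hN : N + 1 = n + (m + 3))
    (hmax : ∀ k, 3 * k + 2 ≤ 2 * n → k ≤ m + 3) :
    IsHalinTuranNumber n (SimpleGraph.cycleGraph 4) N := by
  constructor
  · obtain ⟨H, hH, hfree, hcard⟩ := h.exists_halin
    exact ⟨H, hH, hfree, by omega⟩
  · rintro e ⟨H, hH, hfree, rfl⟩
    have hlt := h.lt
    have hle := h.two_le
    have hn : Nat.card (Fin n) = n := by simp
    obtain ⟨k, hk, hk'⟩ := hH.exists_ncard_edgeSet (by omega) hfree
    rw [hn] at hk hk'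
    have := hmax k hk'
    omega

theorem theorem3 (n : ℕ) (hn : 16 ≤ n) :
    (3 ∣ n - 1 →
      IsHalinTuranNumber n (SimpleGraph.cycleGraph 4) (5 * ((n - 1) / 3))) ∧
    (3 ∣ n - 2 →
      IsHalinTuranNumber n (SimpleGraph.cycleGraph 4) (5 * ((n - 2) / 3) + 1)) ∧
    (3 ∣ n - 3 →
      IsHalinTuranNumber n (SimpleGraph.cycleGraph 4) (5 * ((n - 3) / 3) + 3)) := by
  refine ⟨fun h => ?_, fun h => ?_, fun h => ?_⟩
  · obtain ⟨q, hq⟩ := h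
    exact isHalinTuranNumber_of_isPlaneTreeCode
      (isPlaneTreeCode_star (n := n) (m := 2 * q - 3) (r := q) (by omega) (by omega) (by omega))
      (by omega) (by omega)
  · obtain ⟨q, hq⟩ := h
    -- For `n = 3q + 2` the largest `k` with `3k + 2 ≤ 2n` is `2q`; then `k = 2r + 5 + e` and `n = k
    -- + r + 5` force `r = q - 3`, `e = 1`. From `n ≥ 16` follows `q ≥ 5`, so the root has at least
    -- `r + 1 ≥ 3` children.
    obtain ⟨par, lo, hi, hs⟩ := exists_isTwoHubsVertex (2 * q) (q - 3)
    exact isHalinTuranNumber_of_isPlaneTreeCode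
      (isPlaneTreeCode_twoHubs (n := n) (m := 2 * q - 3) (e := 1) (by omega) (by omega) (by omega)
        (by omega) (by omega) hs) (by omega) (by omega)
  · obtain ⟨q, hq⟩ := h
    -- For `n = 3q + 3` the largest `k` is `2q + 1`, and the additional vertex is one more leaf, `e
    -- = 2`.
    obtain ⟨par, lo, hi, hs⟩ := exists_isTwoHubsVertex (2 * q + 1) (q - 3)
    exact isHalinTuranNumber_of_isPlaneTreeCode
      (isPlaneTreeCode_twoHubs (n := n) (m := 2 * q - 2) (e := 2) (by omega) (by omega) (by omega)
        (by omega) (by omega) hs) (by omega) (by omega)
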